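/- Let $\mathcal G_1,\dots,\mathcal G_M\subseteq\{1,\dots,N\}$ ($M\ge 1$) be groups covering $\{1,\dots,N\}$ that are loopless pairwise overlapping: every element lies in at most two groups, and the group graph, in which two distinct groups are adjacent when they intersect, is a forest. Let $x\in\mathbb R^N$, let $G,K\ge 1$ be integers, and let $A\in\{0,1\}^{N\times M}$ be the matrix with $A_{ij}=1$ iff $i\in\mathcal G_j$. Consider weighted maximum coverage with group budget $G$ and element-sparsity budget $K$: $$\max_{\omega\in\{0,1\}^M,\ y\in\{0,1\}^N}\Big\{\sum_{i=1}^N y_i x_i^2 \;:\; A\omega\ge y,\ \sum_{i=1}^N y_i\le K,\ \sum_{j=1}^M\omega_j\le G\Big\}.$$ The dynamic program is as follows. *Node picking.* Root every tree of the forest at an arbitrary node. For a node with subtrees $T_1,\dots,T_R$ whose $D$-values are sorted as $D_1\ge\dots\ge D_R$, put $D=\max(D_1,D_2+1)$ (missing subtrees count as $0$) and explore, recursively, in the order $T_1$, the node, $T_2,\dots,T_R$. The trees are explored one after the other. A boundary node is an explored node that is adjacent to an unexplored one. *Value update.* For the set of explored nodes, all $1\le g\le G$, $1\le k\le K$ and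 every assignment of $0$ (forbidden) or $1$ (selected) to the boundary nodes, a table stores a value for at most $k$ elements from at most $g$ explored groups, with a selection attaining it. All values are $0$ at the start and for $g=0$ or $k=0$. When a node is explored, it is either rejected, which leaves the values unchanged, or accepted, with the value $\max_{1\le\ell\le k}\{F(g-1,k-\ell)+H(\mathcal X',\ell)\}$, where $F$ is the table before the step (for the same assignment of the boundary nodes), $\mathcal X'$ is the new group without the elements of the boundary groups assigned $1$, and $H(\mathcal X',\ell)$ is the sum of the $\ell$ largest weights $x_i^2$ in $\mathcal X'$ (of all of them if there are fewer than $\ell$). Then, for each node that is no longer a boundary node, the values for $0$ and $1$ are merged by taking the larger one. The result is the entry for $(G,K)$ after all nodes have been explored. **Theorem.** For every choice of the roots: 1. The node picking order lists every node exactly once, and at every step it has at most $\log_2(M)+1$ boundary nodes. 2. The dynamic program returns the optimal value of the problem together with an optimal solution $(\omega,y)$. 3. Its running time, including the computation of the node order, is $O(M^2GK^2)$ with an absolute constant. Here each of the following is one step: an arithmetic operation or comparison, an access to a table entry, a test whether two given groups overlap, and cleaning a group together with looking up $H(\mathcal X',\ell)$ and its elements. 4. It runs in polynomial time also if overlap tests,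 cleaning and $H$ are charged at the cost of explicit elementary subroutines (scanning the ground set, insertion sort): the number of steps is then $O\big(M^2GK^2\,(M+N+1)^2\big)$ with an absolute constant. -/

import Mathlib

/-! ## Step counting

A program is written in the monad `Timed`: it returns a value together with the number of steps
that it has taken. Binding adds the steps, and every step is charged by an explicit `tick`. -/

/-- A value together with the number of steps used to compute it. -/
structure Timed (α : Type) where
  ret : α
  time : ℕ

namespace Timed

instance : Monad Timed where
  pure a := ⟨a, 0⟩
  bind t f := ⟨(f t.ret).ret, t.time + (f t.ret).time⟩

/-- Take `n` steps. -/
def tick (n : ℕ) : Timed Unit := ⟨(), n⟩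

/-- Loop over a list, one step of overhead per item. -/
def foldl {α σ : Type} (f : σ → α → Timed σ) : σ → List α → Timed σ
  | s, [] => pure s
  | s, a :: l => do
    tick 1
    let t ← f s a
    foldl f t l

/-- Apply a program to every item of a list, one step of overhead per item. -/
def map {α β : Type} (f : α → Timed β) : List α → Timed (List β)
  | [] => pure []
  | a :: l => do
    tick 1
    let b ← f a
    let r ← map f l
    pure (b :: r)

/-- Keep the items of a list that pass a test, one step of overhead per item. -/
def filter {α : Type} (p : α → Timed Bool) : List α → Timed (List α)
  | [] => pure []
  | a :: l => do
    tick 1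
    let b ← p a
    let r ← filter p l
    pure (if b then a :: r else r)

/-- Insert an item into a list that is sorted by decreasing `key`, one step per comparison. -/
noncomputable def insertDesc {α κ : Type} [LinearOrder κ] (key : α → κ) (a : α) :
    List α → Timed (List α)
  | [] => do
    tick 1
    pure [a]
  | b :: l => do
    tick 1
    if key b ≤ key a then
      pure (a :: b :: l)
    else do
      let r ← insertDesc key a l
      pure (b :: r)

/-- Insertion sort by decreasing `key`. -/
noncomputable def sortDesc {α κ : Type} [LinearOrder κ] (key : α → κ) : List α → Timed (List α)
  | [] => pure []
  | a :: l => do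
    let s ← sortDesc key l
    insertDesc key a s

end Timed

/-- How the operations on the groups themselves (testing whether two groups overlap; cleaning a
group and looking up its heaviest elements) are charged: as one step each, or at the cost of the
explicit subroutines given below. -/
inductive CostModel
  | unit
  | elementary

/-- Run a subroutine and charge it according to the cost model. -/
def CostModel.charge {α : Type} : CostModel → Timed α → Timed α
  | .unit, t => ⟨t.ret, 1⟩
  | .elementary, t => t

/-! ## Group structures and the optimization problem -/

/-- A group structure: `M` groups that cover the ground set of `N` elements. -/
structure GroupStructure (N M : ℕ) where
  group : Fin M → Finset (Fin N)
  covers : ∀ i, ∃ j, i ∈ group j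

/-- The entries of a table of the dynamic program: a value, and a selection of groups and of
elements that attains it. The elements are kept in batches, one batch for every group, so that
extending a selection by a group takes one step. -/
structure Entry (N M : ℕ) where
  val : ℝ
  groups : List (Fin M)
  batches : List (List (Fin N))

/-- The output of the dynamic program: the value, the chosen groups and the chosen elements. -/
structure Selection (N M : ℕ) where
  val : ℝ
  groups : List (Fin M)
  elems : List (Fin N)

/-- The binary vector of the members of a list. -/
def listIndicator {n : ℕ} (l : List (Fin n)) : Fin n → Fin 2 := fun i => if i ∈ l then 1 else 0

/-- An assignment of the three-valued indicator variables, one for each group: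
`1` is selected, `0` is forbidden, `2` is no restriction. -/
abbrev Assignment (M : ℕ) := Fin M → Fin 3

/-- The table `F(S, g, k, I)` for a fixed set `S` of explored nodes. -/
abbrev Table (N M : ℕ) := Assignment M → ℕ → ℕ → Entry N M

namespace GroupStructure

open Timed

variable {N M : ℕ}

/-- The group graph: two distinct groups are adjacent when they overlap. -/
def groupGraph (𝔊 : GroupStructure N M) : SimpleGraph (Fin M) where
  Adj i j := i ≠ j ∧ (𝔊.group i ∩ 𝔊.group j).Nonempty
  symm := ⟨fun i j h => ⟨h.1.symm, by rw [Finset.inter_comm]; exact h.2⟩⟩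
  loopless := ⟨fun _ h => h.1 rfl⟩

/-- Every element lies in at most two groups, and the group graph is a forest. -/
def LooplessPairwiseOverlapping (𝔊 : GroupStructure N M) : Prop :=
  (∀ i : Fin N, (Finset.univ.filter fun j => i ∈ 𝔊.group j).card ≤ 2) ∧ 𝔊.groupGraph.IsAcyclic

open Classical in
/-- The boundary nodes of a set of explored nodes: the explored nodes that are adjacent to an
unexplored node. -/
noncomputable def boundary (𝔊 : GroupStructure N M) (S : Finset (Fin M)) : Finset (Fin M) :=
  S.filter fun v => ∃ u, u ∉ S ∧ 𝔊.groupGraph.Adj v u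

/-- The bi-adjacency matrix of elements and groups. -/
def biadjacency (𝔊 : GroupStructure N M) : Matrix (Fin N) (Fin M) ℕ :=
  Matrix.of fun i j => if i ∈ 𝔊.group j then 1 else 0

/-- The constraints of weighted maximum coverage with group budget `G` and sparsity budget `K`. -/
structure Feasible (𝔊 : GroupStructure N M) (G K : ℕ) (ω : Fin M → Fin 2) (y : Fin N → Fin 2) :
    Prop where
  covered : ∀ i, (y i : ℕ) ≤ (𝔊.biadjacency.mulVec fun j => (ω j : ℕ)) i
  sparse : ∑ i, (y i : ℕ) ≤ K
  groupSparse : ∑ j, (ω j : ℕ) ≤ G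

/-- The objective `∑ yᵢ xᵢ²`. -/
noncomputable def objective (x : Fin N → ℝ) (y : Fin N → Fin 2) : ℝ :=
  ∑ i, ((y i : ℕ) : ℝ) * x i ^ 2

/-- `(ω, y)` is a solution of weighted maximum coverage with the two budgets. -/
def IsOptimal (𝔊 : GroupStructure N M) (x : Fin N → ℝ) (G K : ℕ) (ω : Fin M → Fin 2)
    (y : Fin N → Fin 2) : Prop :=
  𝔊.Feasible G K ω y ∧ ∀ ω₁ y₁, 𝔊.Feasible G K ω₁ y₁ → objective x y₁ ≤ objective x y

/-! ## Subroutines on the groups -/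

/-- Test whether two groups are adjacent, by scanning the ground set. -/
def adjacent (𝔊 : GroupStructure N M) (i j : Fin M) : Timed Bool := do
  tick (N + 1)
  pure (decide (i ≠ j ∧ (𝔊.group i ∩ 𝔊.group j).Nonempty))

/-- The elements of the group `v` that lie in none of the groups of the list `B` that are selected
by `I`, by testing every element of the ground set against `v` and the groups of `B`. -/
def cleaned (𝔊 : GroupStructure N M) (B : List (Fin M)) (I : Assignment M) (v : Fin M) :
    Timed (List (Fin N)) :=
  Timed.filter (fun i => do
    tick (B.length + 1)
    pure (decide (i ∈ 𝔊.group v ∧ ∀ j ∈ B, I j = 1 → i ∉ 𝔊.group j))) (List.finRange N)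

/-- `H(X, l)` for the cleaned group `X`: the sum of the `l` largest weights in `X` (of all of them
if there are fewer), with the elements that attain it. -/
noncomputable def heaviest (𝔊 : GroupStructure N M) (x : Fin N → ℝ) (B : List (Fin M))
    (I : Assignment M) (v : Fin M) (l : ℕ) : Timed (ℝ × List (Fin N)) := do
  let X ← 𝔊.cleaned B I v
  let s ← sortDesc (fun i => x i ^ 2) X
  tick ((s.take l).length + 1)
  pure (((s.take l).map fun i => x i ^ 2).sum, s.take l)

/-! ## The node picking rule -/

/-- Explore the subtree below `v`, where `p` is the parent of `v`, if it has one, and the first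
argument bounds the depth. Returns the `D`-value of the subtree and the order in which its nodes
are picked: the subtrees at `v` are sorted so that `D₁ ≥ ⋯ ≥ D_R`, the order is
`T₁, v, T₂, …, T_R`, and `D = max (D₁, D₂ + 1)`, where missing subtrees count as `0`.
Concatenating the orders is charged by the length of the result. -/
noncomputable def pick (𝔊 : GroupStructure N M) (c : CostModel) :
    ℕ → Option (Fin M) → Fin M → Timed (ℕ × List (Fin M))
  | 0, _, v => pure (1, [v])
  | n + 1, p, v => do
    let children ← Timed.filter (fun u => do
      let b ← c.charge (𝔊.adjacent v u)
      pure (b && decide (p ≠ some u))) (List.finRange M)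
    let subtrees ← Timed.map (fun u => 𝔊.pick c n (some v) u) children
    let sorted ← sortDesc Prod.fst subtrees
    let D₁ := (sorted.map Prod.fst).getD 0 0
    let D₂ := (sorted.map Prod.fst).getD 1 0
    let order := ((sorted.take 1).map Prod.snd).flatten ++
      v :: ((sorted.drop 1).map Prod.snd).flatten
    tick order.length
    pure (max D₁ (D₂ + 1), order)

/-- The order in which all nodes are explored. The trees of the forest are explored one after the
other. The roots are arbitrary: the candidates are tried in the order given by `root`. -/
noncomputable def nodeOrder (𝔊 : GroupStructure N M) (c : CostModel)
    (root : Equiv.Perm (Fin M)) : Timed (List (Fin M)) :=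
  Timed.foldl (fun acc v => do
    tick acc.length
    if v ∈ acc then
      pure acc
    else do
      let t ← 𝔊.pick c M none v
      tick (acc.length + t.2.length)
      pure (acc ++ t.2)) [] ((List.finRange M).map root)

/-! ## The value update rule -/

/-- The empty selection. -/
def emptyEntry : Entry N M := ⟨0, [], []⟩

/-- The better one of two entries. -/
noncomputable def better (a b : Entry N M) : Timed (Entry N M) := do
  tick 1
  pure (if a.val < b.val then b else a)

/-- The assignments with values in `{0, 1}` on the nodes of the list and the value `2` elsewhere. -/
def assignments : List (Fin M) → List (Assignment M)
  | [] => [fun _ => 2]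
  | b :: B => (assignments B).flatMap fun I => [Function.update I b 0, Function.update I b 1]

/-- Read an entry. Only the entries with `g, k ≥ 1` are stored, the others are empty selections. -/
def readEntry (F : Table N M) (I : Assignment M) (g k : ℕ) : Timed (Entry N M) := do
  tick 1
  pure (if g = 0 ∨ k = 0 then emptyEntry else F I g k)

/-- Write an entry. -/
def writeEntry (F : Table N M) (I : Assignment M) (g k : ℕ) (e : Entry N M) :
    Timed (Table N M) := do
  tick 1
  pure (Function.update F I (Function.update (F I) g (Function.update (F I g) k e)))

/-- Compute and store the entries for `1 ≤ g ≤ G`, `1 ≤ k ≤ K` and all assignments on the nodes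
of `B`. -/
def fillTable (G K : ℕ) (B : List (Fin M))
    (f : Assignment M → ℕ → ℕ → Timed (Entry N M)) : Timed (Table N M) :=
  Timed.foldl (fun F I =>
    Timed.foldl (fun F g =>
      Timed.foldl (fun F k => do
        let e ← f I g k
        writeEntry F I g k e) F (List.range' 1 K)) F (List.range' 1 G))
    (fun _ _ _ => emptyEntry) (assignments B)

/-- The candidate entry in which the new node `v` is accepted and contributes `l` elements: an
optimal selection of `k - l` elements from `g - 1` explored groups, and the `l` heaviest elements
of `v` outside the selected boundary nodes. -/
noncomputable def candidate (𝔊 : GroupStructure N M) (c : CostModel) (x : Fin N → ℝ)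
    (B : List (Fin M)) (F : Table N M) (v : Fin M) (I : Assignment M) (g k l : ℕ) :
    Timed (Entry N M) := do
  let e ← readEntry F I (g - 1) (k - l)
  let h ← c.charge (𝔊.heaviest x B I v l)
  tick 1
  pure ⟨e.val + h.1, v :: e.groups, h.2 :: e.batches⟩

/-- The new node `v` is accepted: the best candidate over `1 ≤ l ≤ k`. -/
noncomputable def accept (𝔊 : GroupStructure N M) (c : CostModel) (x : Fin N → ℝ)
    (B : List (Fin M)) (F : Table N M) (v : Fin M) (I : Assignment M) (g k : ℕ) :
    Timed (Entry N M) := do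
  let e ← 𝔊.candidate c x B F v I g k 1
  Timed.foldl (fun a l => do
    let b ← 𝔊.candidate c x B F v I g k l
    better a b) e (List.range' 2 (k - 1))

/-- The table after the new node `v` has been rejected (`0`) or accepted (`1`), with separate
entries for `v` and for all boundary nodes of the list `B`. -/
noncomputable def extend (𝔊 : GroupStructure N M) (c : CostModel) (x : Fin N → ℝ) (G K : ℕ)
    (B : List (Fin M)) (F : Table N M) (v : Fin M) : Timed (Table N M) :=
  fillTable G K (v :: B) fun J g k =>
    if J v = 0 then readEntry F (Function.update J v 2) g k
    else 𝔊.accept c x B F v (Function.update J v 2) g k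

/-- Condensation: the node `j` has fallen into the interior of the explored nodes, and its two
values are combined. -/
noncomputable def condense (G K : ℕ) (s : List (Fin M) × Table N M) (j : Fin M) :
    Timed (List (Fin M) × Table N M) := do
  tick s.1.length
  let F ← fillTable G K (s.1.erase j) fun I g k => do
    let a ← readEntry s.2 (Function.update I j 0) g k
    let b ← readEntry s.2 (Function.update I j 1) g k
    better a b
  pure (s.1.erase j, F)

end GroupStructure

/-- The state of the dynamic program: for every node the number of its unexplored neighbours, the
list of the boundary nodes, and the table of the explored nodes. -/
structure DPState (N M : ℕ) where
  unexplored : Fin M → ℕ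
  bdry : List (Fin M)
  table : Table N M

namespace GroupStructure

open Timed

variable {N M : ℕ}

/-- The initial state: nothing is explored, and all values are `0`. -/
def initialState (𝔊 : GroupStructure N M) (c : CostModel) (G K : ℕ) : Timed (DPState N M) := do
  let r ← Timed.foldl (fun r v =>
    Timed.foldl (fun r u => do
      let b ← c.charge (𝔊.adjacent v u)
      pure (if b then Function.update r u (r u + 1) else r)) r (List.finRange M))
    (fun _ => 0) (List.finRange M)
  let F ← fillTable G K [] fun _ _ _ => pure emptyEntry
  pure ⟨r, [], F⟩

/-- Explore the node `v`. -/
noncomputable def explore (𝔊 : GroupStructure N M) (c : CostModel) (x : Fin N → ℝ) (G K : ℕ)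
    (s : DPState N M) (v : Fin M) : Timed (DPState N M) := do
  let r ← Timed.foldl (fun r u => do
    let b ← c.charge (𝔊.adjacent v u)
    pure (if b then Function.update r u (r u - 1) else r)) s.unexplored (List.finRange M)
  let F ← 𝔊.extend c x G K s.bdry s.table v
  let interior ← Timed.filter (fun j => pure (decide (r j = 0))) (v :: s.bdry)
  let t ← Timed.foldl (condense G K) (v :: s.bdry, F) interior
  pure ⟨r, t.1, t.2⟩

/-- The dynamic program: order the nodes by the node picking rule, explore them in this order, and
read off the entry for the budgets `G` and `K` without restrictions on any group. -/
noncomputable def dynamicProgram (𝔊 : GroupStructure N M) (c : CostModel) (x : Fin N → ℝ)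
    (G K : ℕ) (root : Equiv.Perm (Fin M)) : Timed (Selection N M) := do
  let order ← 𝔊.nodeOrder c root
  let s₀ ← 𝔊.initialState c G K
  let s ← Timed.foldl (𝔊.explore c x G K) s₀ order
  let e ← readEntry s.table (fun _ => 2) G K
  tick (e.groups.length + e.batches.length + e.batches.flatten.length)
  pure ⟨e.val, e.groups, e.batches.flatten⟩

end GroupStructure


/-!
The `D`-value of a tree is a Strahler number: a tree whose `D`-value is at least `d` has at least
`2 ^ d - 1` nodes. In the order `T₁, v, T₂, …, T_R` the root `v` is explored right after its best
subtree, so at every later moment the boundary consists of `v`, at most, and of the boundary of the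
one subtree `T_r` with `r ≥ 2` that is being explored. Hence there are never more than `D` boundary
nodes, and at most `M + 1` assignments of them.

For the correctness of the table it is enough to compete against selections in which every group has
an element of its own, since redundant groups can be dropped. All explored neighbours of a new node
are boundary nodes, so cleaning its group removes exactly the elements that the selected explored
groups can also cover, and the elements that are left are best chosen greedily.

Each exploration fills `O(M)` tables of size `G K` at a cost of `O(K)` per entry. The condensations
are amortized against the length of the boundary list.
-/

namespace Timed

variable {α β σ : Type}

@[simp] theorem ret_pure (a : α) : (pure a : Timed α).ret = a := rfl

@[simp] theorem time_pure (a : α) : (pure a : Timed α).time = 0 := rfl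

@[simp] theorem ret_bind (t : Timed α) (f : α → Timed β) : (t >>= f).ret = (f t.ret).ret := rfl

@[simp] theorem time_bind (t : Timed α) (f : α → Timed β) :
    (t >>= f).time = t.time + (f t.ret).time := rfl

@[simp] theorem time_tick (n : ℕ) : (tick n).time = n := rfl

section Loops

variable (f : σ → α → Timed σ)

theorem ret_foldl (s : σ) (l : List α) :
    (foldl f s l).ret = l.foldl (fun s a => (f s a).ret) s := by
  induction l generalizing s with
  | nil => rfl
  | cons a l ih => simp [foldl, ih]

theorem ret_foldl_concat (s : σ) (l : List α) (a : α) :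
    (foldl f s (l ++ [a])).ret = (f (foldl f s l).ret a).ret := by
  simp [ret_foldl]

theorem time_foldl_concat (s : σ) (l : List α) (a : α) :
    (foldl f s (l ++ [a])).time = (foldl f s l).time + 1 + (f (foldl f s l).ret a).time := by
  induction l generalizing s with
  | nil => simp [foldl]
  | cons b l ih =>
    simp only [List.cons_append, foldl, time_bind, time_tick, ret_bind, ih]
    ring

variable {f}

theorem time_foldl_le {c : ℕ} {l : List α} (h : ∀ s, ∀ a ∈ l, (f s a).time ≤ c) (s : σ) :
    (foldl f s l).time ≤ l.length * (c + 1) := by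
  induction l generalizing s with
  | nil => simp [foldl]
  | cons a l ih =>
    have hhead := h s a List.mem_cons_self
    have htail := ih (fun s b hb => h s b (List.mem_cons_of_mem a hb)) (f s a).ret
    simp only [foldl, time_bind, time_tick, List.length_cons]
    linarith

theorem ret_foldl_induction {P : σ → Prop} {l : List α}
    (hf : ∀ s, ∀ a ∈ l, P s → P (f s a).ret) {s : σ} (hs : P s) : P (foldl f s l).ret := by
  induction l generalizing s with
  | nil => exact hs
  | cons a l ih =>
    exact ih (fun s b hb => hf s b (List.mem_cons_of_mem a hb)) (hf s a List.mem_cons_self hs)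

theorem ret_foldl_of_mem {P : σ → Prop} {l : List α} (hf : ∀ s, ∀ a ∈ l, P s → P (f s a).ret)
    {a : α} (ha : a ∈ l) (h : ∀ s, P (f s a).ret) (s : σ) : P (foldl f s l).ret := by
  obtain ⟨l₁, l₂, rfl⟩ := List.append_of_mem ha
  simp only [ret_foldl, List.foldl_append, List.foldl_cons]
  rw [← ret_foldl]
  exact ret_foldl_induction (fun s b hb => hf s b (by simp [hb])) (h _)

end Loops

theorem ret_map (f : α → Timed β) (l : List α) : (map f l).ret = l.map fun a => (f a).ret := by
  induction l with
  | nil => rfl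
  | cons a l ih => simp [map, ih]

theorem time_map (f : α → Timed β) (l : List α) :
    (map f l).time = l.length + (l.map fun a => (f a).time).sum := by
  induction l with
  | nil => rfl
  | cons a l ih =>
    simp only [map, time_bind, time_tick, time_pure, ih, List.length_cons, List.map_cons,
      List.sum_cons]
    ring

theorem ret_filter (p : α → Timed Bool) (l : List α) :
    (filter p l).ret = l.filter fun a => (p a).ret := by
  induction l with
  | nil => rfl
  | cons a l ih => simp [filter, ih, List.filter_cons]

theorem time_filter_le {p : α → Timed Bool} {c : ℕ} {l : List α} (h : ∀ a ∈ l, (p a).time ≤ c) :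
    (filter p l).time ≤ l.length * (c + 1) := by
  induction l with
  | nil => simp [filter]
  | cons a l ih =>
    have hhead := h a List.mem_cons_self
    have htail := ih fun b hb => h b (List.mem_cons_of_mem a hb)
    simp only [filter, time_bind, time_tick, time_pure, List.length_cons]
    linarith

section Sorting

variable {κ : Type} [LinearOrder κ] (key : α → κ)

theorem insertDesc_perm (a : α) (l : List α) : (insertDesc key a l).ret.Perm (a :: l) := by
  induction l with
  | nil => simp [insertDesc]
  | cons b l ih =>
    simp only [insertDesc, ret_bind]
    split_ifs
    · rfl
    · exact (ih.cons b).trans (List.Perm.swap a b l)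

theorem insertDesc_pairwise (a : α) {l : List α} (h : l.Pairwise fun b c => key c ≤ key b) :
    (insertDesc key a l).ret.Pairwise fun b c => key c ≤ key b := by
  induction l with
  | nil => simp [insertDesc]
  | cons b l ih =>
    obtain ⟨hb, hl⟩ := List.pairwise_cons.1 h
    simp only [insertDesc, ret_bind]
    split_ifs with hab
    · exact List.pairwise_cons.2
        ⟨List.forall_mem_cons.2 ⟨hab, fun c hc => (hb c hc).trans hab⟩, h⟩
    · refine List.pairwise_cons.2 ⟨fun c hc => ?_, ih hl⟩
      rcases List.mem_cons.1 ((insertDesc_perm key a l).subset hc) with rfl | hc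
      · exact (not_le.1 hab).le
      · exact hb c hc

theorem time_insertDesc_le (a : α) (l : List α) : (insertDesc key a l).time ≤ l.length + 1 := by
  induction l with
  | nil => simp [insertDesc]
  | cons b l ih =>
    simp only [insertDesc, time_bind, time_tick, List.length_cons]
    split_ifs
    · simp
    · simp only [time_bind, time_pure]
      omega

theorem sortDesc_perm (l : List α) : (sortDesc key l).ret.Perm l := by
  induction l with
  | nil => simp [sortDesc]
  | cons a l ih => exact (insertDesc_perm key a _).trans (ih.cons a)

theorem sortDesc_pairwise (l : List α) :
    (sortDesc key l).ret.Pairwise fun b c => key c ≤ key b := by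
  induction l with
  | nil => simp [sortDesc]
  | cons a l ih => exact insertDesc_pairwise key a ih

theorem time_sortDesc_le (l : List α) : (sortDesc key l).time ≤ l.length * l.length := by
  induction l with
  | nil => simp [sortDesc]
  | cons a l ih =>
    have hinsert := time_insertDesc_le key a (sortDesc key l).ret
    rw [(sortDesc_perm key l).length_eq] at hinsert
    simp only [sortDesc, time_bind, List.length_cons]
    nlinarith

theorem insertDesc_map (f : β → α) (a : β) (l : List β) :
    (insertDesc key (f a) (l.map f)).ret = (insertDesc (fun b => key (f b)) a l).ret.map f := by
  induction l with
  | nil => simp [insertDesc]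
  | cons b l ih =>
    simp only [insertDesc, ret_bind, List.map_cons]
    split_ifs <;> simp [ih]

theorem sortDesc_map (f : β → α) (l : List β) :
    (sortDesc key (l.map f)).ret = (sortDesc (fun b => key (f b)) l).ret.map f := by
  induction l with
  | nil => simp [sortDesc]
  | cons a l ih => simp [sortDesc, ih, insertDesc_map]

end Sorting

end Timed

@[simp] theorem CostModel.ret_charge {α : Type} (c : CostModel) (t : Timed α) :
    (c.charge t).ret = t.ret := by
  cases c <;> rfl

section Branch

variable {V : Type*} {G : SimpleGraph V}

/-- The nodes that can be reached from `v` without entering `p`: the subtree below `v` if `p` is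
the parent of `v`, and the component of `v` if there is no parent. -/
def branch (G : SimpleGraph V) (p : Option V) (v : V) : Set V :=
  {u | Relation.ReflTransGen (fun a b => G.Adj a b ∧ p ≠ some b) v u}

theorem self_mem_branch (p : Option V) (v : V) : v ∈ branch G p v := Relation.ReflTransGen.refl

theorem mem_branch_of_adj {p : Option V} {v a b : V} (ha : a ∈ branch G p v) (hab : G.Adj a b)
    (hb : p ≠ some b) : b ∈ branch G p v :=
  Relation.ReflTransGen.tail ha ⟨hab, hb⟩

theorem mem_branch_trans {p : Option V} {u v w : V} (huv : v ∈ branch G p u)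
    (hvw : w ∈ branch G p v) : w ∈ branch G p u :=
  Relation.ReflTransGen.trans huv hvw

theorem ne_of_mem_branch {p v u : V} (hpv : p ≠ v) (hu : u ∈ branch G (some p) v) : u ≠ p := by
  rintro rfl
  rcases Relation.ReflTransGen.cases_tail hu with h | ⟨b, -, -, hb⟩
  · exact hpv h
  · exact hb rfl

theorem mem_branch_symm {p u v : V} (hpv : p ≠ v) (hu : u ∈ branch G (some p) v) :
    v ∈ branch G (some p) u := by
  induction hu with
  | refl => exact self_mem_branch _ _
  | tail hab hbc ih =>
    exact .head ⟨hbc.1.symm, fun h => ne_of_mem_branch hpv hab (Option.some.inj h).symm⟩ ih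

theorem reachable_deleteEdges_of_mem_branch {p v u w : V} (hpv : p ≠ v)
    (hu : u ∈ branch G (some p) v) : (G.deleteEdges {s(p, w)}).Reachable v u := by
  induction hu with
  | refl => rfl
  | @tail a b ha hab ih =>
    have hap : a ≠ p := ne_of_mem_branch hpv ha
    have hbp : b ≠ p := fun h => hab.2 (congrArg some h.symm)
    refine ih.trans (SimpleGraph.Adj.reachable ?_)
    simp [SimpleGraph.deleteEdges_adj, hab.1, hap, hbp]

section Acyclic

variable (hG : G.IsAcyclic)
include hG

/-- Otherwise the edge from `p` to `w` would not be a bridge. -/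
theorem eq_of_adj_of_mem_branch {p v w : V} (hv : G.Adj p v) (hw : G.Adj p w)
    (hwv : w ∈ branch G (some p) v) : w = v := by
  by_contra hne
  refine SimpleGraph.isBridge_iff.1 (SimpleGraph.isAcyclic_iff_forall_adj_isBridge.1 hG hw) ?_
  refine (SimpleGraph.Adj.reachable ?_).trans (reachable_deleteEdges_of_mem_branch hv.ne hwv)
  simp [SimpleGraph.deleteEdges_adj, hv, hv.ne', Ne.symm hne]

theorem branch_disjoint {v a b : V} (ha : G.Adj v a) (hb : G.Adj v b) (hab : a ≠ b) :
    Disjoint (branch G (some v) a) (branch G (some v) b) := by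
  rw [Set.disjoint_left]
  intro u hua hub
  exact hab (eq_of_adj_of_mem_branch hG hb ha (mem_branch_trans hub (mem_branch_symm ha.ne hua)))

variable {p : Option V} {v : V} (hp : ∀ q ∈ p, G.Adj v q)
include hp

theorem branch_child_subset {a : V} (ha : G.Adj v a) (hpa : p ≠ some a) :
    branch G (some v) a ⊆ branch G p v := by
  have hparent : ∀ b ∈ branch G (some v) a, p ≠ some b := by
    rintro b hb rfl
    exact hpa (congrArg some (eq_of_adj_of_mem_branch hG ha (hp b rfl) hb))
  intro u hu
  induction hu with
  | refl => exact mem_branch_of_adj (self_mem_branch _ _) ha hpa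
  | tail hab hbc ih => exact mem_branch_of_adj ih hbc.1 (hparent _ (.tail hab hbc))

theorem mem_branch_iff {u : V} :
    u ∈ branch G p v ↔ u = v ∨ ∃ a, (G.Adj v a ∧ p ≠ some a) ∧ u ∈ branch G (some v) a := by
  constructor
  · intro hu
    induction hu with
    | refl => exact Or.inl rfl
    | @tail b c _ hbc ih =>
      refine or_iff_not_imp_left.2 fun hcv => ?_
      rcases ih with rfl | ⟨a, ha, hb⟩
      · exact ⟨c, hbc, self_mem_branch _ _⟩
      · exact ⟨a, ha, mem_branch_of_adj hb hbc.1 fun h => hcv (Option.some.inj h).symm⟩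
  · rintro (rfl | ⟨a, ha, hu⟩)
    · exact self_mem_branch _ _
    · exact branch_child_subset hG hp ha.1 ha.2 hu

end Acyclic

end Branch

section ExploredInOrder

variable {α : Type*} {S : Finset α} {L R : List α}

/-- The nodes of the list `L` are explored in the order of the list, where `S` is the set of all
explored nodes, on `L` or elsewhere: the explored nodes of `L` are an initial segment of `L`. -/
def ExploredInOrder (S : Finset α) (L : List α) : Prop :=
  L.Pairwise fun a b => b ∈ S → a ∈ S

theorem exploredInOrder_take [DecidableEq α] (hL : L.Nodup) (m : ℕ) :
    ExploredInOrder (L.take m).toFinset L := by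
  have hmem : ∀ a ∈ L.take m, a ∈ (L.take m).toFinset := fun a ha => List.mem_toFinset.2 ha
  have hdrop : ∀ b ∈ L.drop m, b ∉ (L.take m).toFinset := fun b hb hb' =>
    List.disjoint_take_drop hL le_rfl (List.mem_toFinset.1 hb') hb
  suffices ExploredInOrder (L.take m).toFinset (L.take m ++ L.drop m) by
    rwa [List.take_append_drop] at this
  refine List.pairwise_append.2 ⟨?_, ?_, fun a ha _ _ _ => hmem a ha⟩
  · exact List.pairwise_of_forall_mem_list fun a ha _ _ _ => hmem a ha
  · exact List.pairwise_of_forall_mem_list fun a _ b hb h => absurd h (hdrop b hb)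

theorem ExploredInOrder.of_append_left (h : ExploredInOrder S (L ++ R)) : ExploredInOrder S L :=
  (List.pairwise_append.1 h).1

theorem ExploredInOrder.of_append_right (h : ExploredInOrder S (L ++ R)) : ExploredInOrder S R :=
  (List.pairwise_append.1 h).2.1

theorem ExploredInOrder.mem_of_append (h : ExploredInOrder S (L ++ R)) {b : α} (hb : b ∈ R)
    (hbS : b ∈ S) : ∀ a ∈ L, a ∈ S :=
  fun a ha => (List.pairwise_append.1 h).2.2 a ha b hb hbS

end ExploredInOrder

namespace GroupStructure

open Timed

variable {N M : ℕ} {𝔊 : GroupStructure N M}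

section Boundary

variable {S : Finset (Fin M)} {L R : List (Fin M)}

theorem mem_boundary {v : Fin M} :
    v ∈ 𝔊.boundary S ↔ v ∈ S ∧ ∃ u, u ∉ S ∧ 𝔊.groupGraph.Adj v u := by
  simp [boundary]

theorem boundary_inter_eq_empty_of_unexplored (hL : ∀ u ∈ L, u ∉ S) :
    𝔊.boundary S ∩ L.toFinset = ∅ := by
  simp only [← Finset.disjoint_iff_inter_eq_empty, Finset.disjoint_left, mem_boundary,
    List.mem_toFinset]
  exact fun u hu hL' => hL u hL' hu.1

theorem boundary_inter_eq_empty_of_explored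
    (hL : ∀ u ∈ L, ∀ w, 𝔊.groupGraph.Adj u w → w ∈ S) : 𝔊.boundary S ∩ L.toFinset = ∅ := by
  simp only [← Finset.disjoint_iff_inter_eq_empty, Finset.disjoint_left, mem_boundary,
    List.mem_toFinset]
  rintro u ⟨-, w, hw, hadj⟩ hu
  exact hw (hL u hu w hadj)

theorem card_boundary_inter_append_le :
    (𝔊.boundary S ∩ (L ++ R).toFinset).card ≤
      (𝔊.boundary S ∩ L.toFinset).card + (𝔊.boundary S ∩ R.toFinset).card := by
  rw [List.toFinset_append, Finset.inter_union_distrib_left]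
  exact Finset.card_union_le _ _

/-- Once a node on `R` is explored, all of `L` is, so `L` contains no boundary nodes. -/
theorem card_boundary_inter_append_le_max
    (hL : ∀ u ∈ L, ∀ w, 𝔊.groupGraph.Adj u w → w ∈ L ∨ w ∈ S) (hS : ExploredInOrder S (L ++ R)) :
    (𝔊.boundary S ∩ (L ++ R).toFinset).card ≤
      max (𝔊.boundary S ∩ L.toFinset).card (𝔊.boundary S ∩ R.toFinset).card := by
  refine card_boundary_inter_append_le.trans ?_
  by_cases hR : ∃ b ∈ R, b ∈ S
  · obtain ⟨b, hb, hbS⟩ := hR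
    rw [boundary_inter_eq_empty_of_explored (L := L), Finset.card_empty, Nat.zero_add]
    · exact le_max_right _ _
    · exact fun u hu w hw => (hL u hu w hw).elim (hS.mem_of_append hb hbS w) id
  · push Not at hR
    rw [boundary_inter_eq_empty_of_unexplored hR, Finset.card_empty, Nat.add_zero]
    exact le_max_left _ _

theorem card_boundary_inter_flatMap_le {ι : Type*} {l : List ι} {L : ι → List (Fin M)} {d : ℕ}
    (hL : ∀ i ∈ l, ∀ u ∈ L i, ∀ w, 𝔊.groupGraph.Adj u w → w ∈ L i ∨ w ∈ S)
    (hd : ∀ i ∈ l, ExploredInOrder S (L i) → (𝔊.boundary S ∩ (L i).toFinset).card ≤ d)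
    (hS : ExploredInOrder S (l.flatMap L)) :
    (𝔊.boundary S ∩ (l.flatMap L).toFinset).card ≤ d := by
  induction l with
  | nil => simp
  | cons i l ih =>
    rw [List.flatMap_cons] at hS ⊢
    refine (card_boundary_inter_append_le_max (hL i List.mem_cons_self) hS).trans (max_le ?_ ?_)
    · exact hd i List.mem_cons_self hS.of_append_left
    · exact ih (fun j hj => hL j (List.mem_cons_of_mem i hj))
        (fun j hj => hd j (List.mem_cons_of_mem i hj)) hS.of_append_right

/-- The first subtree, its parent `v`, and the other subtrees: as long as `v` is unexplored, all
boundary nodes are in the first subtree, and later they are `v` and nodes of the others. -/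
theorem card_boundary_inter_middle_le {v : Fin M} {d₁ d₂ : ℕ}
    (hLv : ∀ u ∈ L, ∀ w, 𝔊.groupGraph.Adj u w → w ∈ L ∨ w = v)
    (hd₁ : ExploredInOrder S L → (𝔊.boundary S ∩ L.toFinset).card ≤ d₁)
    (hd₂ : v ∈ S → ExploredInOrder S R → (𝔊.boundary S ∩ R.toFinset).card ≤ d₂)
    (hS : ExploredInOrder S (L ++ v :: R)) :
    (𝔊.boundary S ∩ (L ++ v :: R).toFinset).card ≤ max d₁ (d₂ + 1) := by
  obtain ⟨hvR, hSR⟩ := List.pairwise_cons.1 hS.of_append_right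
  by_cases hv : v ∈ S
  · have hcons := card_boundary_inter_append_le (𝔊 := 𝔊) (S := S) (L := [v]) (R := R)
    have hone : (𝔊.boundary S ∩ [v].toFinset).card ≤ 1 :=
      (Finset.card_le_card Finset.inter_subset_right).trans (by simp)
    have hR := hd₂ hv hSR
    have hL : ∀ u ∈ L, ∀ w, 𝔊.groupGraph.Adj u w → w ∈ L ∨ w ∈ S := fun u hu w hw =>
      (hLv u hu w hw).imp_right fun h : w = v => h.symm ▸ hv
    refine (card_boundary_inter_append_le_max hL hS).trans (max_le_max (hd₁ hS.of_append_left) ?_)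
    rw [List.singleton_append] at hcons
    omega
  · refine card_boundary_inter_append_le.trans ?_
    rw [boundary_inter_eq_empty_of_unexplored (L := v :: R), Finset.card_empty, Nat.add_zero]
    · exact (hd₁ hS.of_append_left).trans (le_max_left _ _)
    · exact List.forall_mem_cons.2 ⟨hv, fun b hb hbS => hv (hvR b hb hbS)⟩

end Boundary

section Pick

@[simp] theorem ret_adjacent (i j : Fin M) :
    (𝔊.adjacent i j).ret = true ↔ 𝔊.groupGraph.Adj i j := by
  simp [adjacent, groupGraph]

/-- The nodes from which the subtrees below `v` start, where `p` is the parent of `v`. -/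
def children (𝔊 : GroupStructure N M) (p : Option (Fin M)) (v : Fin M) : List (Fin M) :=
  (List.finRange M).filter fun u => (𝔊.adjacent v u).ret && decide (p ≠ some u)

theorem mem_children {p : Option (Fin M)} {v u : Fin M} :
    u ∈ 𝔊.children p v ↔ 𝔊.groupGraph.Adj v u ∧ p ≠ some u := by
  simp [children]

theorem nodup_children (p : Option (Fin M)) (v : Fin M) : (𝔊.children p v).Nodup :=
  (List.nodup_finRange M).filter _

/-- The `D`-value of the subtree below `v`, as computed by `pick`. -/
noncomputable abbrev subtreeRank (𝔊 : GroupStructure N M) (c : CostModel) (n : ℕ)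
    (p : Option (Fin M)) (v : Fin M) : ℕ :=
  (𝔊.pick c n p v).ret.1

/-- The order in which `pick` explores the subtree below `v`. -/
noncomputable abbrev subtreeOrder (𝔊 : GroupStructure N M) (c : CostModel) (n : ℕ)
    (p : Option (Fin M)) (v : Fin M) : List (Fin M) :=
  (𝔊.pick c n p v).ret.2

/-- The children of `v`, sorted by decreasing `D`-value. -/
noncomputable def sortedChildren (𝔊 : GroupStructure N M) (c : CostModel) (n : ℕ)
    (p : Option (Fin M)) (v : Fin M) : List (Fin M) :=
  (sortDesc (𝔊.subtreeRank c n (some v)) (𝔊.children p v)).ret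

variable (c : CostModel) (n : ℕ) (p : Option (Fin M)) (v : Fin M)

theorem sortedChildren_perm : (𝔊.sortedChildren c n p v).Perm (𝔊.children p v) :=
  sortDesc_perm _ _

theorem ret_pick_succ :
    (𝔊.pick c (n + 1) p v).ret =
      (max (((𝔊.sortedChildren c n p v).map (𝔊.subtreeRank c n (some v))).getD 0 0)
          (((𝔊.sortedChildren c n p v).map (𝔊.subtreeRank c n (some v))).getD 1 0 + 1),
        ((𝔊.sortedChildren c n p v).take 1).flatMap (𝔊.subtreeOrder c n (some v)) ++
          v :: ((𝔊.sortedChildren c n p v).drop 1).flatMap (𝔊.subtreeOrder c n (some v))) := by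
  have hsort := sortDesc_map Prod.fst (fun u => (𝔊.pick c n (some v) u).ret) (𝔊.children p v)
  simp only [pick, ret_bind, ret_pure, ret_filter, ret_map, CostModel.ret_charge]
  rw [← children, hsort]
  simp only [sortedChildren, List.map_take, List.map_drop, List.flatMap, List.map_map,
    Function.comp_def]

theorem subtreeOrder_succ_perm :
    (𝔊.subtreeOrder c (n + 1) p v).Perm
      (v :: (𝔊.children p v).flatMap (𝔊.subtreeOrder c n (some v))) := by
  rw [subtreeOrder, ret_pick_succ]
  refine List.perm_middle.trans (List.Perm.cons v ?_)
  rw [← List.flatMap_append, List.take_append_drop]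
  exact (sortedChildren_perm c n p v).flatMap_right _

variable {c n p v}

theorem ret_pick_succ_of_nil (h : 𝔊.sortedChildren c n p v = []) :
    (𝔊.pick c (n + 1) p v).ret = (1, [v]) := by
  simp [ret_pick_succ, h]

theorem ret_pick_succ_of_cons {b : Fin M} {l : List (Fin M)}
    (h : 𝔊.sortedChildren c n p v = b :: l) :
    (𝔊.pick c (n + 1) p v).ret =
      (max (𝔊.subtreeRank c n (some v) b)
          ((l.map (𝔊.subtreeRank c n (some v))).getD 0 0 + 1),
        𝔊.subtreeOrder c n (some v) b ++ v :: l.flatMap (𝔊.subtreeOrder c n (some v))) := by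
  simp [ret_pick_succ, h]

theorem subtreeRank_pairwise_of_cons {b : Fin M} {l : List (Fin M)}
    (h : 𝔊.sortedChildren c n p v = b :: l) :
    (𝔊.subtreeRank c n (some v) b :: l.map (𝔊.subtreeRank c n (some v))).Pairwise (· ≥ ·) := by
  have hsort := sortDesc_pairwise (𝔊.subtreeRank c n (some v)) (𝔊.children p v)
  rw [← sortedChildren, h] at hsort
  exact hsort.map (S := (· ≥ ·)) (𝔊.subtreeRank c n (some v)) fun _ _ hab => hab

theorem two_pow_subtreeRank_le :
    2 ^ 𝔊.subtreeRank c n p v ≤ (𝔊.subtreeOrder c n p v).length + 1 := by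
  induction n generalizing p v with
  | zero => exact le_rfl
  | succ n ih =>
    rcases h : 𝔊.sortedChildren c n p v with - | ⟨b, l⟩
    · simp [subtreeRank, subtreeOrder, ret_pick_succ_of_nil h]
    · have hsort := subtreeRank_pairwise_of_cons h
      rw [subtreeRank, subtreeOrder, ret_pick_succ_of_cons h]
      simp only [List.length_append, List.length_cons]
      have hfirst := ih (p := some v) (v := b)
      set d₁ := 𝔊.subtreeRank c n (some v) b
      set d₂ := (l.map (𝔊.subtreeRank c n (some v))).getD 0 0 with hd₂
      have hsecond : 2 ^ d₂ ≤ (l.flatMap (𝔊.subtreeOrder c n (some v))).length + 1 := by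
        rcases l with - | ⟨b', l⟩
        · simp [hd₂]
        · have := ih (p := some v) (v := b')
          simp only [hd₂, List.map_cons, List.getD_cons_zero, List.flatMap_cons,
            List.length_append]
          omega
      have hle : d₂ ≤ d₁ := by
        rcases l with - | ⟨b', l⟩
        · simp [hd₂]
        · exact List.rel_of_pairwise_cons hsort List.mem_cons_self
      have hpow : 2 ^ d₂ ≤ 2 ^ d₁ := Nat.pow_le_pow_right two_pos hle
      rcases max_choice d₁ (d₂ + 1) with h | h <;> rw [h]
      · omega
      · rw [pow_succ]
        omega

theorem time_pick_succ_le {a : ℕ} (ha : ∀ i j, (c.charge (𝔊.adjacent i j)).time ≤ a) (n : ℕ)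
    (p : Option (Fin M)) (v : Fin M) :
    (𝔊.pick c (n + 1) p v).time ≤ M * (a + 1) + (𝔊.children p v).length * (M + 1) +
      ((𝔊.children p v).map fun u => (𝔊.pick c n (some v) u).time).sum +
      (𝔊.subtreeOrder c (n + 1) p v).length := by
  have hfilter := time_filter_le (p := fun u => do
    let b ← c.charge (𝔊.adjacent v u)
    pure (b && decide (p ≠ some u))) (c := a) (l := List.finRange M) fun u _ => by
      simpa using ha v u
  have hsort := time_sortDesc_le Prod.fst
    ((𝔊.children p v).map fun u => (𝔊.pick c n (some v) u).ret)
  have hdegree : (𝔊.children p v).length ≤ M := by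
    simpa using (nodup_children (𝔊 := 𝔊) p v).length_le_card
  rw [List.length_map] at hsort
  rw [List.length_finRange] at hfilter
  simp only [subtreeOrder, pick, ret_bind, ret_pure, time_bind, time_pure, time_tick, ret_filter,
    ret_map, time_map, CostModel.ret_charge, Nat.add_zero]
  rw [← children]
  nlinarith

end Pick

section SubtreeOfForest

/-- The node `v` is a root of the forest (if `p` is `none`) or the child of the node `p`, and the
depth bound `n` suffices for the subtree below `v`. -/
structure IsSubtreeRoot (𝔊 : GroupStructure N M) (n : ℕ) (p : Option (Fin M)) (v : Fin M) :
    Prop where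
  adj : ∀ q ∈ p, 𝔊.groupGraph.Adj v q
  ncard_le : (branch 𝔊.groupGraph p v).ncard ≤ n

theorem isSubtreeRoot_none (v : Fin M) : 𝔊.IsSubtreeRoot M none v where
  adj := by simp
  ncard_le := by simpa using Set.ncard_le_card (branch 𝔊.groupGraph none v)

theorem IsSubtreeRoot.pos {n : ℕ} {p : Option (Fin M)} {v : Fin M}
    (h : 𝔊.IsSubtreeRoot n p v) : 0 < n :=
  ((Set.ncard_pos (Set.toFinite _)).2 ⟨v, self_mem_branch p v⟩).trans_le h.ncard_le

variable (hG : 𝔊.groupGraph.IsAcyclic) {c : CostModel} {n : ℕ} {p : Option (Fin M)} {v : Fin M}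
include hG

theorem IsSubtreeRoot.child (h : 𝔊.IsSubtreeRoot (n + 1) p v) {u : Fin M}
    (hu : u ∈ 𝔊.children p v) : 𝔊.IsSubtreeRoot n (some v) u := by
  obtain ⟨hadj, hpu⟩ := mem_children.1 hu
  refine ⟨fun q hq => Option.some.inj hq ▸ hadj.symm, Nat.le_of_lt_succ ?_⟩
  refine (Set.ncard_lt_ncard ?_ (Set.toFinite _)).trans_le h.ncard_le
  exact ⟨branch_child_subset hG h.adj hadj hpu,
    fun hsub => ne_of_mem_branch hadj.ne (hsub (self_mem_branch p v)) rfl⟩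

theorem mem_subtreeOrder_iff (h : 𝔊.IsSubtreeRoot n p v) {u : Fin M} :
    u ∈ 𝔊.subtreeOrder c n p v ↔ u ∈ branch 𝔊.groupGraph p v := by
  induction n generalizing p v with
  | zero => exact absurd h.pos (lt_irrefl 0)
  | succ n ih =>
    rw [(subtreeOrder_succ_perm c n p v).mem_iff, mem_branch_iff hG h.adj, List.mem_cons,
      List.mem_flatMap]
    simp only [← mem_children]
    exact or_congr_right (exists_congr fun a => and_congr_right fun ha => ih (h.child hG ha))

theorem mem_subtreeOrder_of_adj (h : 𝔊.IsSubtreeRoot n p v) {u w : Fin M}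
    (hu : u ∈ 𝔊.subtreeOrder c n p v) (hw : 𝔊.groupGraph.Adj u w) :
    w ∈ 𝔊.subtreeOrder c n p v ∨ p = some w := by
  simp only [mem_subtreeOrder_iff hG h] at hu ⊢
  exact or_iff_not_imp_right.2 (mem_branch_of_adj hu hw)

theorem nodup_subtreeOrder (h : 𝔊.IsSubtreeRoot n p v) : (𝔊.subtreeOrder c n p v).Nodup := by
  induction n generalizing p v with
  | zero => exact absurd h.pos (lt_irrefl 0)
  | succ n ih =>
    rw [(subtreeOrder_succ_perm c n p v).nodup_iff, List.nodup_cons, List.nodup_flatMap]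
    refine ⟨fun hv => ?_, fun u hu => ih (h.child hG hu), ?_⟩
    · obtain ⟨u, hu, hvu⟩ := List.mem_flatMap.1 hv
      rw [mem_subtreeOrder_iff hG (h.child hG hu)] at hvu
      exact ne_of_mem_branch (mem_children.1 hu).1.ne hvu rfl
    · refine (nodup_children p v).pairwise_of_forall_ne fun a ha b hb hab u hua hub => ?_
      rw [mem_subtreeOrder_iff hG (h.child hG ha)] at hua
      rw [mem_subtreeOrder_iff hG (h.child hG hb)] at hub
      exact Set.disjoint_left.1
        (branch_disjoint hG (mem_children.1 ha).1 (mem_children.1 hb).1 hab) hua hub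

theorem card_boundary_inter_subtreeOrder_le (h : 𝔊.IsSubtreeRoot n p v) {S : Finset (Fin M)}
    (hS : ExploredInOrder S (𝔊.subtreeOrder c n p v)) :
    (𝔊.boundary S ∩ (𝔊.subtreeOrder c n p v).toFinset).card ≤ 𝔊.subtreeRank c n p v := by
  induction n generalizing p v with
  | zero => exact absurd h.pos (lt_irrefl 0)
  | succ n ih =>
    rcases hsorted : 𝔊.sortedChildren c n p v with - | ⟨b, l⟩
    · rw [subtreeOrder, subtreeRank, ret_pick_succ_of_nil hsorted]
      exact (Finset.card_le_card Finset.inter_subset_right).trans (by simp)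
    · have hchild : ∀ u ∈ b :: l, 𝔊.IsSubtreeRoot n (some v) u := fun u hu =>
        h.child hG ((sortedChildren_perm c n p v).subset (hsorted ▸ hu))
      have hnear : ∀ u ∈ b :: l, ∀ a ∈ 𝔊.subtreeOrder c n (some v) u, ∀ w,
          𝔊.groupGraph.Adj a w → w ∈ 𝔊.subtreeOrder c n (some v) u ∨ w = v :=
        fun u hu a ha w hw => (mem_subtreeOrder_of_adj hG (hchild u hu) ha hw).imp_right
          fun h => (Option.some.inj h).symm
      have hrank : ∀ u ∈ l, 𝔊.subtreeRank c n (some v) u ≤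
          (l.map (𝔊.subtreeRank c n (some v))).getD 0 0 := by
        have hsort := (List.pairwise_cons.1 (subtreeRank_pairwise_of_cons hsorted)).2
        rcases l with - | ⟨b', l⟩
        · simp
        · rw [List.map_cons] at hsort
          exact List.forall_mem_cons.2 ⟨le_rfl, fun u hu =>
            List.rel_of_pairwise_cons hsort (List.mem_map_of_mem hu)⟩
      rw [subtreeOrder, ret_pick_succ_of_cons hsorted] at hS
      rw [subtreeOrder, subtreeRank, ret_pick_succ_of_cons hsorted]
      refine card_boundary_inter_middle_le (hnear b List.mem_cons_self)
        (ih (hchild b List.mem_cons_self)) (fun hv => ?_) hS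
      refine card_boundary_inter_flatMap_le (fun u hu a ha w hw => ?_) fun u hu hSu => ?_
      · exact (hnear u (List.mem_cons_of_mem b hu) a ha w hw).imp_right
          fun h : w = v => h.symm ▸ hv
      · exact (ih (hchild u (List.mem_cons_of_mem b hu)) hSu).trans (hrank u hu)

/-- Each child pays `M + 1` steps for its part in the sorting of the children. -/
theorem time_pick_le (h : 𝔊.IsSubtreeRoot n p v) {a : ℕ}
    (ha : ∀ i j, (c.charge (𝔊.adjacent i j)).time ≤ a) :
    (𝔊.pick c n p v).time + (M + 1) ≤
      (M * (a + 3) + 1) * (𝔊.subtreeOrder c n p v).length := by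
  induction n generalizing p v with
  | zero => exact absurd h.pos (lt_irrefl 0)
  | succ n ih =>
    have hchildren : ((𝔊.children p v).map fun u => (𝔊.pick c n (some v) u).time + (M + 1)).sum ≤
        (M * (a + 3) + 1) *
          ((𝔊.children p v).flatMap (𝔊.subtreeOrder c n (some v))).length := by
      rw [List.length_flatMap, ← List.sum_map_mul_left]
      exact List.sum_le_sum fun u hu => ih (h.child hG hu)
    have htime := time_pick_succ_le ha n p v
    have horder := (subtreeOrder_succ_perm (𝔊 := 𝔊) c n p v).length_eq
    have hM := (nodup_subtreeOrder (c := c) hG h).length_le_card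
    rw [List.sum_map_add, List.map_const', List.sum_replicate, smul_eq_mul] at hchildren
    rw [List.length_cons] at horder
    rw [Fintype.card_fin] at hM
    rw [horder] at hM htime ⊢
    linarith

end SubtreeOfForest

section NodeOrder

/-- Explore the tree of `v`, unless this has been done before: one step of `nodeOrder`. -/
noncomputable def addTree (𝔊 : GroupStructure N M) (c : CostModel) (acc : List (Fin M))
    (v : Fin M) : Timed (List (Fin M)) := do
  tick acc.length
  if v ∈ acc then
    pure acc
  else do
    let t ← 𝔊.pick c M none v
    tick (acc.length + t.2.length)
    pure (acc ++ t.2)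

theorem nodeOrder_eq_foldl (c : CostModel) (root : Equiv.Perm (Fin M)) :
    𝔊.nodeOrder c root = Timed.foldl (𝔊.addTree c) [] ((List.finRange M).map root) := rfl

/-- The list `acc` explores some of the trees of the forest, with few boundary nodes at every
step. -/
structure ExploresTrees (𝔊 : GroupStructure N M) (acc : List (Fin M)) : Prop where
  nodup : acc.Nodup
  closed : ∀ u ∈ acc, ∀ w, 𝔊.groupGraph.Adj u w → w ∈ acc
  two_pow_le : ∀ S : Finset (Fin M), ExploredInOrder S acc →
    2 ^ (𝔊.boundary S ∩ acc.toFinset).card ≤ M + 1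

theorem ret_addTree (c : CostModel) (acc : List (Fin M)) (v : Fin M) :
    (𝔊.addTree c acc v).ret = if v ∈ acc then acc else acc ++ 𝔊.subtreeOrder c M none v := by
  by_cases hv : v ∈ acc <;> simp [addTree, hv]

variable (hG : 𝔊.groupGraph.IsAcyclic) {c : CostModel}
include hG

theorem exploresTrees_subtreeOrder (v : Fin M) :
    𝔊.ExploresTrees (𝔊.subtreeOrder c M none v) where
  nodup := nodup_subtreeOrder hG (isSubtreeRoot_none v)
  closed u hu w hw :=
    (mem_subtreeOrder_of_adj hG (isSubtreeRoot_none v) hu hw).resolve_right (by simp)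
  two_pow_le S hS := by
    have hlen := (nodup_subtreeOrder (c := c) hG (isSubtreeRoot_none v)).length_le_card
    rw [Fintype.card_fin] at hlen
    calc 2 ^ (𝔊.boundary S ∩ (𝔊.subtreeOrder c M none v).toFinset).card
      _ ≤ 2 ^ 𝔊.subtreeRank c M none v :=
        Nat.pow_le_pow_right two_pos
          (card_boundary_inter_subtreeOrder_le hG (isSubtreeRoot_none v) hS)
      _ ≤ (𝔊.subtreeOrder c M none v).length + 1 := two_pow_subtreeRank_le
      _ ≤ M + 1 := Nat.add_le_add_right hlen 1

theorem disjoint_subtreeOrder {acc : List (Fin M)}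
    (hacc : ∀ u ∈ acc, ∀ w, 𝔊.groupGraph.Adj u w → w ∈ acc) {v : Fin M} (hv : v ∉ acc) :
    acc.Disjoint (𝔊.subtreeOrder c M none v) := by
  intro u hu huv
  rw [mem_subtreeOrder_iff hG (isSubtreeRoot_none v)] at huv
  induction huv with
  | refl => exact hv hu
  | tail _ hbc ih => exact ih (hacc _ hu _ hbc.1.symm)

theorem ExploresTrees.addTree {acc : List (Fin M)} (h : 𝔊.ExploresTrees acc) (v : Fin M) :
    𝔊.ExploresTrees (𝔊.addTree c acc v).ret := by
  rw [ret_addTree]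
  split_ifs with hv
  · exact h
  have hv' := exploresTrees_subtreeOrder (c := c) hG v
  refine ⟨h.nodup.append hv'.nodup (disjoint_subtreeOrder hG h.closed hv), ?_, fun S hS => ?_⟩
  · intro u hu w hw
    rw [List.mem_append] at hu ⊢
    exact hu.imp (fun hu => h.closed u hu w hw) fun hu => hv'.closed u hu w hw
  · have hmax := card_boundary_inter_append_le_max
      (fun u hu w hw => Or.inl (h.closed u hu w hw)) hS
    refine (Nat.pow_le_pow_right two_pos hmax).trans ?_
    rcases max_choice (𝔊.boundary S ∩ acc.toFinset).card
      (𝔊.boundary S ∩ (𝔊.subtreeOrder c M none v).toFinset).card with heq | heq <;> rw [heq]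
    · exact h.two_pow_le S hS.of_append_left
    · exact hv'.two_pow_le S hS.of_append_right

theorem exploresTrees_foldl_addTree (l : List (Fin M)) :
    𝔊.ExploresTrees (Timed.foldl (𝔊.addTree c) [] l).ret :=
  ret_foldl_induction (fun _ v _ h => h.addTree hG v)
    ⟨List.nodup_nil, by simp, by simp⟩

theorem nodup_nodeOrder (root : Equiv.Perm (Fin M)) : (𝔊.nodeOrder c root).ret.Nodup := by
  rw [nodeOrder_eq_foldl]
  exact (exploresTrees_foldl_addTree hG _).nodup

theorem mem_nodeOrder (root : Equiv.Perm (Fin M)) (v : Fin M) :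
    v ∈ (𝔊.nodeOrder c root).ret := by
  rw [nodeOrder_eq_foldl]
  refine ret_foldl_of_mem (P := fun acc => v ∈ acc) (a := v) (fun acc u _ hacc => ?_)
    (List.mem_map.2 ⟨root.symm v, by simp⟩) (fun acc => ?_) _ <;> rw [ret_addTree] <;> split_ifs
  · exact hacc
  · exact List.mem_append_left _ hacc
  · assumption
  · rw [List.mem_append, mem_subtreeOrder_iff hG (isSubtreeRoot_none v)]
    exact Or.inr (self_mem_branch _ _)

theorem two_pow_card_boundary_nodeOrder_le (root : Equiv.Perm (Fin M)) (m : ℕ) :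
    2 ^ (𝔊.boundary ((𝔊.nodeOrder c root).ret.take m).toFinset).card ≤ M + 1 := by
  have hall : (𝔊.nodeOrder c root).ret.toFinset = Finset.univ :=
    Finset.eq_univ_iff_forall.2 fun v => List.mem_toFinset.2 (mem_nodeOrder hG root v)
  have htrees : 𝔊.ExploresTrees (𝔊.nodeOrder c root).ret := exploresTrees_foldl_addTree hG _
  have hpow := htrees.two_pow_le _ (exploredInOrder_take htrees.nodup m)
  rwa [hall, Finset.inter_univ] at hpow

theorem time_foldl_addTree_le {a : ℕ} (ha : ∀ i j, (c.charge (𝔊.adjacent i j)).time ≤ a)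
    (l : List (Fin M)) :
    (Timed.foldl (𝔊.addTree c) [] l).time ≤ l.length * (2 * M + 1) +
      (M * (a + 3) + 1) * (Timed.foldl (𝔊.addTree c) [] l).ret.length := by
  induction l using List.reverseRecOn with
  | nil => simp [foldl]
  | append_singleton l v ih =>
    have hlen := (exploresTrees_foldl_addTree (c := c) hG l).nodup.length_le_card
    rw [Fintype.card_fin] at hlen
    rw [time_foldl_concat, ret_foldl_concat, List.length_append, List.length_singleton]
    set acc := (Timed.foldl (𝔊.addTree c) [] l).ret
    have hpick := time_pick_le hG (isSubtreeRoot_none v) ha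
    have hstep : (𝔊.addTree c acc v).time + (M * (a + 3) + 1) * acc.length ≤
        2 * M + (M * (a + 3) + 1) * (𝔊.addTree c acc v).ret.length := by
      by_cases hv : v ∈ acc
      · simp only [addTree, hv, if_true, ret_bind, ret_pure, time_bind, time_tick, time_pure]
        omega
      · have hsub := (exploresTrees_subtreeOrder (c := c) hG v).nodup.length_le_card
        rw [Fintype.card_fin] at hsub
        simp only [addTree, hv, if_false, ret_bind, ret_pure, time_bind, time_tick, time_pure,
          List.length_append]
        nlinarith
    nlinarith

theorem time_nodeOrder_le {a : ℕ} (ha : ∀ i j, (c.charge (𝔊.adjacent i j)).time ≤ a)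
    (root : Equiv.Perm (Fin M)) :
    (𝔊.nodeOrder c root).time ≤ M * (2 * M + 1) + (M * (a + 3) + 1) * M := by
  have htime := time_foldl_addTree_le hG ha ((List.finRange M).map root)
  have hlen := (nodup_nodeOrder (c := c) hG root).length_le_card
  rw [Fintype.card_fin] at hlen
  rw [← nodeOrder_eq_foldl, List.length_map, List.length_finRange] at htime
  exact htime.trans (by gcongr)

end NodeOrder

end GroupStructure

namespace GroupStructure

open Timed

variable {N M : ℕ} {𝔊 : GroupStructure N M} {x : Fin N → ℝ}

section Assignments

variable {B : List (Fin M)} {I : Assignment M}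

theorem mem_assignments : I ∈ assignments B ↔ ∀ j, I j ≠ 2 ↔ j ∈ B := by
  induction B generalizing I with
  | nil => simp [assignments, funext_iff]
  | cons b B ih =>
    simp only [assignments, List.mem_flatMap, List.mem_cons, List.not_mem_nil, or_false, ih]
    constructor
    · rintro ⟨I', hI', rfl | rfl⟩ j <;> rcases eq_or_ne j b with rfl | hj <;> simp_all
    · intro h
      have hb : I b = 0 ∨ I b = 1 := by
        have := (h b).2 (Or.inl rfl)
        omega
      refine ⟨Function.update I b (if b ∈ B then I b else 2), fun j => ?_, ?_⟩
      · rcases eq_or_ne j b with rfl | hj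
        · have := (h j).2 (Or.inl rfl)
          by_cases hjB : j ∈ B <;> simp_all
        · simp [hj, h j]
      · rcases hb with hb | hb
        · exact Or.inl (by simp [← hb])
        · exact Or.inr (by simp [← hb])

theorem length_assignments (B : List (Fin M)) : (assignments B).length = 2 ^ B.length := by
  induction B with
  | nil => rfl
  | cons b B ih => simp [assignments, List.length_flatMap, ih, pow_succ]

theorem update_mem_assignments {j : Fin M} (hj : j ∈ B) (hI : I ∈ assignments (B.erase j))
    {b : Fin 3} (hb : b ≠ 2) : Function.update I j b ∈ assignments B := by
  rw [mem_assignments] at hI ⊢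
  intro i
  rcases eq_or_ne i j with rfl | hij
  · simp [hb, hj]
  · rw [Function.update_of_ne hij, hI, List.mem_erase_of_ne hij]

theorem update_two_mem_assignments {v : Fin M} (hv : v ∉ B) (hI : I ∈ assignments (v :: B)) :
    Function.update I v 2 ∈ assignments B := by
  rw [mem_assignments] at hI ⊢
  intro i
  rcases eq_or_ne i v with rfl | hiv
  · simp [hv]
  · rw [Function.update_of_ne hiv, hI, List.mem_cons, or_iff_right hiv]

end Assignments

/-- The elements of `Y` that `v` is the only group of `W` to contain. -/
def privateElems (𝔊 : GroupStructure N M) (W : Finset (Fin M)) (Y : Finset (Fin N)) (v : Fin M) :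
    Finset (Fin N) :=
  Y.filter fun i => ∀ j ∈ W, i ∈ 𝔊.group j → j = v

theorem mem_privateElems {W : Finset (Fin M)} {Y : Finset (Fin N)} {v : Fin M} {i : Fin N} :
    i ∈ 𝔊.privateElems W Y v ↔ i ∈ Y ∧ ∀ j ∈ W, i ∈ 𝔊.group j → j = v := by
  simp [privateElems]

theorem privateElems_subset (W : Finset (Fin M)) (Y : Finset (Fin N)) (v : Fin M) :
    𝔊.privateElems W Y v ⊆ Y :=
  Finset.filter_subset _ _

/-- What the dynamic program may return for an assignment `I` and budgets `g` and `k`: an entry that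
attains its value by at most `k` distinct elements from at most `g` distinct groups of `S`, none of
them forbidden. The groups that `I` requires may be missing: for `g = 0` or `k = 0` every entry is
empty. -/
structure IsSelection (𝔊 : GroupStructure N M) (x : Fin N → ℝ) (S : Finset (Fin M))
    (I : Assignment M) (g k : ℕ) (e : Entry N M) : Prop where
  groups_nodup : e.groups.Nodup
  groups_subset : ∀ j ∈ e.groups, j ∈ S
  groups_length_le : e.groups.length ≤ g
  batches_length : e.batches.length = e.groups.length
  elems_nodup : e.batches.flatten.Nodup
  elems_length_le : e.batches.flatten.length ≤ k
  elems_covered : ∀ i ∈ e.batches.flatten, ∃ j ∈ e.groups, i ∈ 𝔊.group j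
  allowed : ∀ j ∈ e.groups, I j ≠ 0
  val_eq : e.val = (e.batches.flatten.map fun i => x i ^ 2).sum

/-- What an entry of the dynamic program has to beat: a choice of groups `W ⊆ S` and elements `Y`
that agrees with the assignment `I`. Since an accepted node always contributes an element, only
choices without redundant groups are considered. -/
structure IsCompetitor (𝔊 : GroupStructure N M) (S : Finset (Fin M)) (I : Assignment M) (g k : ℕ)
    (W : Finset (Fin M)) (Y : Finset (Fin N)) : Prop where
  subset : W ⊆ S
  card_groups_le : W.card ≤ g
  card_elems_le : Y.card ≤ k
  covered : ∀ i ∈ Y, ∃ j ∈ W, i ∈ 𝔊.group j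
  irredundant : ∀ j ∈ W, (𝔊.privateElems W Y j).Nonempty
  selected : ∀ j, I j = 1 → j ∈ W
  allowed : ∀ j ∈ W, I j ≠ 0

/-- A correct entry of a table: a selection that is at least as good as all its competitors. -/
structure IsBest (𝔊 : GroupStructure N M) (x : Fin N → ℝ) (S : Finset (Fin M)) (I : Assignment M)
    (g k : ℕ) (e : Entry N M) : Prop extends 𝔊.IsSelection x S I g k e where
  le_val : ∀ W Y, 𝔊.IsCompetitor S I g k W Y → ∑ i ∈ Y, x i ^ 2 ≤ e.val

/-- All entries of the table for the explored nodes `S` and the boundary nodes `B` are correct. -/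
def TableCorrect (𝔊 : GroupStructure N M) (x : Fin N → ℝ) (G K : ℕ) (S : Finset (Fin M))
    (B : List (Fin M)) (F : Table N M) : Prop :=
  ∀ I ∈ assignments B, ∀ g ≤ G, ∀ k ≤ K, 𝔊.IsBest x S I g k (readEntry F I g k).ret

section Selections

variable {S T : Finset (Fin M)} {I J : Assignment M} {g k : ℕ} {e : Entry N M} {v : Fin M}
  {W : Finset (Fin M)} {Y : Finset (Fin N)}

theorem IsSelection.mono (h : 𝔊.IsSelection x S I g k e) (hST : S ⊆ T)
    (hIJ : ∀ j ∈ e.groups, I j ≠ 0 → J j ≠ 0) : 𝔊.IsSelection x T J g k e :=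
  { h with
    groups_subset := fun j hj => hST (h.groups_subset j hj)
    allowed := fun j hj => hIJ j hj (h.allowed j hj) }

theorem IsSelection.cons (h : 𝔊.IsSelection x S I g k e) (hv : v ∉ S) (hIv : I v ≠ 0)
    {X : List (Fin N)} (hX : X.Nodup) (hXv : ∀ i ∈ X, i ∈ 𝔊.group v)
    (hXe : ∀ i ∈ X, ∀ j ∈ e.groups, i ∉ 𝔊.group j) :
    𝔊.IsSelection x (insert v S) I (g + 1) (k + X.length)
      ⟨e.val + (X.map fun i => x i ^ 2).sum, v :: e.groups, X :: e.batches⟩ where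
  groups_nodup := List.nodup_cons.2 ⟨fun hve => hv (h.groups_subset v hve), h.groups_nodup⟩
  groups_subset := List.forall_mem_cons.2
    ⟨Finset.mem_insert_self v S, fun j hj => Finset.mem_insert_of_mem (h.groups_subset j hj)⟩
  groups_length_le := Nat.succ_le_succ h.groups_length_le
  batches_length := congrArg Nat.succ h.batches_length
  elems_nodup := by
    rw [List.flatten_cons, List.nodup_append']
    refine ⟨hX, h.elems_nodup, fun i hi hie => ?_⟩
    obtain ⟨j, hj, hij⟩ := h.elems_covered i hie
    exact hXe i hi j hj hij
  elems_length_le := by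
    have := h.elems_length_le
    rw [List.flatten_cons, List.length_append]
    omega
  elems_covered i hi := by
    rcases List.mem_append.1 (List.flatten_cons ▸ hi) with hi | hi
    · exact ⟨v, List.mem_cons_self, hXv i hi⟩
    · obtain ⟨j, hj, hij⟩ := h.elems_covered i hi
      exact ⟨j, List.mem_cons_of_mem v hj, hij⟩
  allowed := List.forall_mem_cons.2 ⟨hIv, h.allowed⟩
  val_eq := by
    rw [List.flatten_cons, List.map_append, List.sum_append, ← h.val_eq, add_comm]

theorem IsSelection.mono_card {k' : ℕ} (h : 𝔊.IsSelection x S I g k e) (hk : k ≤ k') :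
    𝔊.IsSelection x S I g k' e :=
  { h with elems_length_le := h.elems_length_le.trans hk }

theorem IsCompetitor.update (h : 𝔊.IsCompetitor S I g k W Y) {b : Fin 3} (hb₁ : b = 1 → v ∈ W)
    (hb₀ : b = 0 → v ∉ W) : 𝔊.IsCompetitor S (Function.update I v b) g k W Y :=
  { h with
    selected := fun j hj => by
      rcases eq_or_ne j v with rfl | hjv
      · exact hb₁ (by simpa using hj)
      · exact h.selected j (by rwa [Function.update_of_ne hjv] at hj)
    allowed := fun j hj => by
      rcases eq_or_ne j v with rfl | hjv
      · rw [Function.update_self]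
        exact fun hb => hb₀ hb hj
      · rw [Function.update_of_ne hjv]
        exact h.allowed j hj }

theorem IsCompetitor.erase (h : 𝔊.IsCompetitor (insert v S) I g k W Y) (hvW : v ∈ W)
    (hIv : I v ≠ 1) :
    𝔊.IsCompetitor S I (g - 1) (k - (𝔊.privateElems W Y v).card) (W.erase v)
      (Y \ 𝔊.privateElems W Y v) where
  subset j hj := Finset.mem_of_mem_insert_of_ne (h.subset (Finset.mem_of_mem_erase hj))
    (Finset.ne_of_mem_erase hj)
  card_groups_le := by
    rw [Finset.card_erase_of_mem hvW]
    exact Nat.sub_le_sub_right h.card_groups_le 1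
  card_elems_le := by
    rw [Finset.card_sdiff_of_subset (privateElems_subset W Y v)]
    exact Nat.sub_le_sub_right h.card_elems_le _
  covered i hi := by
    simp only [Finset.mem_sdiff, mem_privateElems, not_and, not_forall] at hi
    obtain ⟨j, hj, hij, hjv⟩ := hi.2 hi.1
    exact ⟨j, Finset.mem_erase.2 ⟨hjv, hj⟩, hij⟩
  irredundant j hj := by
    obtain ⟨hjv, hjW⟩ := Finset.mem_erase.1 hj
    obtain ⟨i, hi⟩ := h.irredundant j hjW
    obtain ⟨hiY, hprivate⟩ := mem_privateElems.1 hi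
    obtain ⟨j', hj'W, hij'⟩ := h.covered i hiY
    obtain rfl := hprivate j' hj'W hij'
    refine ⟨i, mem_privateElems.2 ⟨Finset.mem_sdiff.2 ⟨hiY, fun hiv => ?_⟩, fun m hm =>
      hprivate m (Finset.mem_of_mem_erase hm)⟩⟩
    exact hjv ((mem_privateElems.1 hiv).2 j' hj'W hij')
  selected j hj := Finset.mem_erase.2 ⟨by rintro rfl; exact hIv hj, h.selected j hj⟩
  allowed j hj := h.allowed j (Finset.mem_of_mem_erase hj)

theorem isBest_emptyEntry (h : S = ∅ ∨ g = 0 ∨ k = 0) : 𝔊.IsBest x S I g k emptyEntry where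
  groups_nodup := List.nodup_nil
  groups_subset := by simp [emptyEntry]
  groups_length_le := Nat.zero_le g
  batches_length := rfl
  elems_nodup := List.nodup_nil
  elems_length_le := Nat.zero_le k
  elems_covered := by simp [emptyEntry]
  allowed := by simp [emptyEntry]
  val_eq := rfl
  le_val W Y hWY := by
    have hW : W = ∅ → Y = ∅ := by
      rintro rfl
      exact Finset.eq_empty_of_forall_notMem fun i hi => by simpa using hWY.covered i hi
    have hY : Y = ∅ := by
      rcases h with rfl | rfl | rfl
      · exact hW (Finset.subset_empty.1 hWY.subset)
      · exact hW (Finset.card_eq_zero.1 (Nat.le_zero.1 hWY.card_groups_le))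
      · exact Finset.card_eq_zero.1 (Nat.le_zero.1 hWY.card_elems_le)
    simp [hY, emptyEntry]

end Selections

section Filling

variable {G K : ℕ} {S : Finset (Fin M)} {B : List (Fin M)}
  {f : Assignment M → ℕ → ℕ → Timed (Entry N M)}

theorem ret_writeEntry_apply (F : Table N M) (I I' : Assignment M) (g g' k k' : ℕ)
    (e : Entry N M) :
    (writeEntry F I' g' k' e).ret I g k =
      if I = I' ∧ g = g' ∧ k = k' then e else F I g k := by
  rcases eq_or_ne I I' with rfl | hI
  · rcases eq_or_ne g g' with rfl | hg
    · rcases eq_or_ne k k' with rfl | hk <;> simp [writeEntry, *]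
    · simp [writeEntry, hg]
  · simp [writeEntry, hI]

theorem fillTable_apply {I : Assignment M} (hI : I ∈ assignments B) {g : ℕ} (hg₁ : 1 ≤ g)
    (hg : g ≤ G) {k : ℕ} (hk₁ : 1 ≤ k) (hk : k ≤ K) :
    (fillTable G K B f).ret I g k = (f I g k).ret := by
  let P : Table N M → Prop := fun F => F I g k = (f I g k).ret
  have hwrite : ∀ F I' g' k', P F → P (do
      let e ← f I' g' k'
      writeEntry F I' g' k' e : Timed _).ret := by
    intro F I' g' k' hF
    simp only [P, ret_bind, ret_writeEntry_apply]
    split_ifs with h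
    · obtain ⟨rfl, rfl, rfl⟩ := h
      rfl
    · exact hF
  have hrow : ∀ F I' g', P F → P (Timed.foldl (fun F k => do
      let e ← f I' g' k
      writeEntry F I' g' k e) F (List.range' 1 K)).ret :=
    fun F I' g' hF => ret_foldl_induction (fun F k' _ => hwrite F I' g' k') hF
  refine ret_foldl_of_mem (P := P) (fun F I' _ hF => ?_) hI (fun F => ?_) _
  · exact ret_foldl_induction (fun F g' _ => hrow F I' g') hF
  · refine ret_foldl_of_mem (P := P) (fun F g' _ => hrow F I g')
      (a := g) (List.mem_range'_1.2 (by omega)) (fun F => ?_) F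
    refine ret_foldl_of_mem (P := P) (fun F k' _ => hwrite F I g k')
      (a := k) (List.mem_range'_1.2 (by omega)) (fun F => ?_) F
    simp [P, ret_writeEntry_apply]

theorem tableCorrect_fillTable
    (h : ∀ I ∈ assignments B, ∀ g, 1 ≤ g → g ≤ G → ∀ k, 1 ≤ k → k ≤ K →
      𝔊.IsBest x S I g k (f I g k).ret) :
    𝔊.TableCorrect x G K S B (fillTable G K B f).ret := by
  intro I hI g hg k hk
  simp only [readEntry, ret_bind, ret_pure]
  split_ifs with h0
  · exact isBest_emptyEntry (Or.inr h0)
  · rw [fillTable_apply hI (by omega) hg (by omega) hk]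
    exact h I hI g (by omega) hg k (by omega) hk

end Filling

section Better

variable (a b : Entry N M)

theorem ret_better_eq_or : (better a b).ret = a ∨ (better a b).ret = b := by
  simp only [better, ret_bind, ret_pure]
  exact (ite_eq_or_eq _ b a).symm

theorem left_val_le_better : a.val ≤ (better a b).ret.val := by
  simp only [better, ret_bind, ret_pure]
  split_ifs with h
  exacts [h.le, le_rfl]

theorem right_val_le_better : b.val ≤ (better a b).ret.val := by
  simp only [better, ret_bind, ret_pure]
  split_ifs with h
  exacts [le_rfl, not_lt.1 h]

end Better

section Condensation

variable {S : Finset (Fin M)} {I : Assignment M} {j : Fin M} {g k : ℕ}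

theorem IsSelection.of_update {e : Entry N M} {b : Fin 3} (hj : I j ≠ 0)
    (h : 𝔊.IsSelection x S (Function.update I j b) g k e) : 𝔊.IsSelection x S I g k e :=
  h.mono subset_rfl fun i _ hi => by
    rcases eq_or_ne i j with rfl | hij
    · exact hj
    · rwa [Function.update_of_ne hij] at hi

theorem isBest_better {e₀ e₁ : Entry N M} (hj : I j ≠ 0)
    (h₀ : 𝔊.IsBest x S (Function.update I j 0) g k e₀)
    (h₁ : 𝔊.IsBest x S (Function.update I j 1) g k e₁) :
    𝔊.IsBest x S I g k (better e₀ e₁).ret where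
  toIsSelection := by
    rcases ret_better_eq_or e₀ e₁ with h | h <;> rw [h]
    · exact h₀.toIsSelection.of_update hj
    · exact h₁.toIsSelection.of_update hj
  le_val W Y hWY := by
    by_cases hjW : j ∈ W
    · exact (h₁.le_val W Y (hWY.update (fun _ => hjW) (by simp))).trans
        (right_val_le_better e₀ e₁)
    · exact (h₀.le_val W Y (hWY.update (by simp) fun _ => hjW)).trans
        (left_val_le_better e₀ e₁)

theorem tableCorrect_condense {G K : ℕ} {B : List (Fin M)} {F : Table N M} (hB : B.Nodup)
    (hj : j ∈ B) (hF : 𝔊.TableCorrect x G K S B F) :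
    𝔊.TableCorrect x G K S (B.erase j) (condense G K (B, F) j).ret.2 := by
  refine tableCorrect_fillTable fun I hI g _ hg k _ hk => ?_
  have hIj : I j = 2 := not_not.1 (mt (mem_assignments.1 hI j).1 hB.not_mem_erase)
  exact isBest_better (by simp [hIj])
    (hF _ (update_mem_assignments hj hI (by simp)) g hg k hk)
    (hF _ (update_mem_assignments hj hI (by simp)) g hg k hk)

end Condensation

section Heaviest

theorem sum_le_sum_take_of_pairwise {α : Type*} {w : α → ℝ} (hw : ∀ a, 0 ≤ w a)
    {L : List α} (hL : L.Pairwise fun b c => w c ≤ w b) {l : ℕ} {Y : Finset α}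
    (hYL : ∀ a ∈ Y, a ∈ L) (hY : Y.card ≤ l) : ∑ a ∈ Y, w a ≤ ((L.take l).map w).sum := by
  classical
  induction L generalizing l Y with
  | nil =>
    obtain rfl : Y = ∅ := Finset.eq_empty_of_forall_notMem fun a ha => by simpa using hYL a ha
    simp
  | cons b L ih =>
    obtain ⟨hb, hL⟩ := List.pairwise_cons.1 hL
    rcases Y.eq_empty_or_nonempty with rfl | hne
    · rw [Finset.sum_empty]
      exact List.sum_nonneg (List.forall_mem_map.2 fun a _ => hw a)
    obtain ⟨l, rfl⟩ : ∃ l', l = l' + 1 := Nat.exists_eq_add_of_le' (hne.card_pos.trans_le hY)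
    obtain ⟨a, ha, hab, hrest⟩ : ∃ a ∈ Y, w a ≤ w b ∧ ∀ c ∈ Y.erase a, c ∈ L := by
      by_cases hbY : b ∈ Y
      · exact ⟨b, hbY, le_rfl, fun c hc => List.mem_of_ne_of_mem (Finset.ne_of_mem_erase hc)
          (hYL c (Finset.mem_of_mem_erase hc))⟩
      · have hYL' : ∀ c ∈ Y, c ∈ L := fun c hc =>
          List.mem_of_ne_of_mem (by rintro rfl; exact hbY hc) (hYL c hc)
        obtain ⟨a, ha⟩ := hne
        exact ⟨a, ha, hb a (hYL' a ha), fun c hc => hYL' c (Finset.mem_of_mem_erase hc)⟩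
    rw [← Finset.add_sum_erase _ _ ha, List.take_succ_cons, List.map_cons, List.sum_cons]
    refine add_le_add hab (ih hL hrest ?_)
    rw [Finset.card_erase_of_mem ha]
    exact Nat.sub_le_of_le_add hY

variable {B : List (Fin M)} {I : Assignment M} {v : Fin M} {i : Fin N} {l : ℕ}

theorem mem_cleaned :
    i ∈ (𝔊.cleaned B I v).ret ↔ i ∈ 𝔊.group v ∧ ∀ j ∈ B, I j = 1 → i ∉ 𝔊.group j := by
  simp [cleaned, ret_filter]

theorem nodup_cleaned : (𝔊.cleaned B I v).ret.Nodup := by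
  rw [cleaned, ret_filter]
  exact (List.nodup_finRange N).filter _

theorem nodup_heaviest : (𝔊.heaviest x B I v l).ret.2.Nodup :=
  ((sortDesc_perm _ _).nodup_iff.2 nodup_cleaned).sublist (List.take_sublist l _)

theorem length_heaviest_le : (𝔊.heaviest x B I v l).ret.2.length ≤ l :=
  List.length_take_le l _

theorem mem_cleaned_of_mem_heaviest (hi : i ∈ (𝔊.heaviest x B I v l).ret.2) :
    i ∈ (𝔊.cleaned B I v).ret :=
  (sortDesc_perm _ _).subset (List.mem_of_mem_take hi)

theorem sum_le_heaviest {Y : Finset (Fin N)} (hY : ∀ i ∈ Y, i ∈ (𝔊.cleaned B I v).ret)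
    (hcard : Y.card ≤ l) : ∑ i ∈ Y, x i ^ 2 ≤ (𝔊.heaviest x B I v l).ret.1 :=
  sum_le_sum_take_of_pairwise (fun i => sq_nonneg (x i)) (sortDesc_pairwise (x · ^ 2) _)
    (fun i hi => (sortDesc_perm _ _).mem_iff.2 (hY i hi)) hcard

end Heaviest

section Acceptance

variable {c : CostModel} {B : List (Fin M)} {F : Table N M} {v : Fin M} {I : Assignment M}
  {g k l : ℕ}

theorem ret_candidate :
    (𝔊.candidate c x B F v I g k l).ret =
      ⟨(readEntry F I (g - 1) (k - l)).ret.val + (𝔊.heaviest x B I v l).ret.1,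
        v :: (readEntry F I (g - 1) (k - l)).ret.groups,
        (𝔊.heaviest x B I v l).ret.2 :: (readEntry F I (g - 1) (k - l)).ret.batches⟩ := by
  simp [candidate]

theorem exists_ret_accept_eq_candidate (hk : 1 ≤ k) :
    ∃ l ≤ k, (𝔊.accept c x B F v I g k).ret = (𝔊.candidate c x B F v I g k l).ret := by
  refine ret_foldl_induction (P := fun a => ∃ l ≤ k, a = (𝔊.candidate c x B F v I g k l).ret)
    (fun a l hl ha => ?_) ⟨1, hk, rfl⟩
  rw [List.mem_range'_1] at hl
  rw [ret_bind]
  rcases ret_better_eq_or a (𝔊.candidate c x B F v I g k l).ret with h | h <;> rw [h]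
  exacts [ha, ⟨l, by omega, rfl⟩]

theorem candidate_val_le_accept (hl₁ : 1 ≤ l) (hl : l ≤ k) :
    (𝔊.candidate c x B F v I g k l).ret.val ≤ (𝔊.accept c x B F v I g k).ret.val := by
  let P : Entry N M → Prop := fun a => (𝔊.candidate c x B F v I g k l).ret.val ≤ a.val
  have hstep : ∀ a, ∀ l' ∈ List.range' 2 (k - 1), P a →
      P (do let b ← 𝔊.candidate c x B F v I g k l'; better a b : Timed _).ret :=
    fun a _ _ ha => ha.trans (left_val_le_better a _)
  rcases hl₁.eq_or_lt with rfl | hl₁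
  · exact ret_foldl_induction hstep le_rfl
  · exact ret_foldl_of_mem hstep (List.mem_range'_1.2 (by omega))
      (fun a => right_val_le_better a _) _

theorem notMem_group_of_mem_cleaned (hI : I ∈ assignments B) {j : Fin M}
    (hvj : 𝔊.groupGraph.Adj v j → j ∈ B) (hne : v ≠ j) (hj : I j ≠ 0) {i : Fin N}
    (hi : i ∈ (𝔊.cleaned B I v).ret) : i ∉ 𝔊.group j := by
  intro hij
  obtain ⟨hiv, hclean⟩ := mem_cleaned.1 hi
  have hjB : j ∈ B := hvj ⟨hne, i, Finset.mem_inter.2 ⟨hiv, hij⟩⟩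
  have hj2 : I j ≠ 2 := (mem_assignments.1 hI j).2 hjB
  exact hclean j hjB (by omega) hij

theorem IsCompetitor.mem_cleaned_of_mem_privateElems {S W : Finset (Fin M)} {Y : Finset (Fin N)}
    (h : 𝔊.IsCompetitor S I g k W Y) (hIv : I v ≠ 1) {i : Fin N}
    (hi : i ∈ 𝔊.privateElems W Y v) : i ∈ (𝔊.cleaned B I v).ret := by
  obtain ⟨hiY, hprivate⟩ := mem_privateElems.1 hi
  obtain ⟨j, hjW, hij⟩ := h.covered i hiY
  refine mem_cleaned.2 ⟨hprivate j hjW hij ▸ hij, fun j' _ hj' hij' => hIv ?_⟩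
  exact hprivate j' (h.selected j' hj') hij' ▸ hj'

variable {S : Finset (Fin M)} {J : Assignment M}

theorem isSelection_candidate (hv : v ∉ S) (hB : ∀ j ∈ S, 𝔊.groupGraph.Adj v j → j ∈ B)
    (hI : I ∈ assignments B) (hIv : I v ≠ 0) (hg : 1 ≤ g) (hl : l ≤ k)
    (hF : 𝔊.IsSelection x S I (g - 1) (k - l) (readEntry F I (g - 1) (k - l)).ret) :
    𝔊.IsSelection x (insert v S) I g k (𝔊.candidate c x B F v I g k l).ret := by
  have hlength := length_heaviest_le (𝔊 := 𝔊) (x := x) (B := B) (I := I) (v := v) (l := l)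
  have hcons := hF.cons hv hIv (nodup_heaviest (x := x) (l := l))
    (fun i hi => (mem_cleaned.1 (mem_cleaned_of_mem_heaviest hi)).1)
    (fun i hi j hj => notMem_group_of_mem_cleaned hI (hB j (hF.groups_subset j hj))
      (by rintro rfl; exact hv (hF.groups_subset _ hj)) (hF.allowed j hj)
      (mem_cleaned_of_mem_heaviest hi))
  rw [Nat.sub_add_cancel hg] at hcons
  rw [ret_candidate]
  exact hcons.mono_card (by omega)

theorem exists_le_candidate_val (hIv : I v ≠ 1)
    (hF : ∀ l, 1 ≤ l → l ≤ k →
      𝔊.IsBest x S I (g - 1) (k - l) (readEntry F I (g - 1) (k - l)).ret)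
    {W : Finset (Fin M)} {Y : Finset (Fin N)} (h : 𝔊.IsCompetitor (insert v S) I g k W Y)
    (hvW : v ∈ W) :
    ∃ l, 1 ≤ l ∧ l ≤ k ∧ ∑ i ∈ Y, x i ^ 2 ≤ (𝔊.candidate c x B F v I g k l).ret.val := by
  have hsub := privateElems_subset (𝔊 := 𝔊) W Y v
  have hl₁ : 1 ≤ (𝔊.privateElems W Y v).card := (h.irredundant v hvW).card_pos
  have hl : (𝔊.privateElems W Y v).card ≤ k := (Finset.card_le_card hsub).trans h.card_elems_le
  refine ⟨_, hl₁, hl, ?_⟩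
  rw [ret_candidate, ← Finset.sum_sdiff hsub]
  exact add_le_add ((hF _ hl₁ hl).le_val _ _ (h.erase hvW hIv))
    (sum_le_heaviest (fun i hi => h.mem_cleaned_of_mem_privateElems hIv hi) le_rfl)

theorem isBest_accept (hv : v ∉ S) (hB : ∀ j ∈ S, 𝔊.groupGraph.Adj v j → j ∈ B)
    (hI : Function.update J v 2 ∈ assignments B) (hJv : J v = 1) (hg : 1 ≤ g) (hk : 1 ≤ k)
    (hF : ∀ l ≤ k, 𝔊.IsBest x S (Function.update J v 2) (g - 1) (k - l)
      (readEntry F (Function.update J v 2) (g - 1) (k - l)).ret) :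
    𝔊.IsBest x (insert v S) J g k (𝔊.accept c x B F v (Function.update J v 2) g k).ret where
  toIsSelection := by
    obtain ⟨l, hl, heq⟩ := exists_ret_accept_eq_candidate (𝔊 := 𝔊) (c := c) (x := x) (B := B)
      (F := F) (v := v) (I := Function.update J v 2) (g := g) hk
    rw [heq]
    exact (isSelection_candidate hv hB hI (by simp) hg hl (hF l hl).toIsSelection).of_update
      (by simp [hJv])
  le_val W Y hWY := by
    obtain ⟨l, hl₁, hl, hle⟩ := exists_le_candidate_val (c := c) (B := B) (by simp)
      (fun l _ hl => hF l hl) (hWY.update (b := 2) (by simp) (by simp)) (hWY.selected v hJv)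
    exact hle.trans (candidate_val_le_accept hl₁ hl)

theorem IsBest.insert_of_forbidden {e : Entry N M} (hv : v ∉ S) (hJv : J v = 0)
    (h : 𝔊.IsBest x S (Function.update J v 2) g k e) : 𝔊.IsBest x (insert v S) J g k e where
  toIsSelection := h.toIsSelection.mono (Finset.subset_insert v S) fun j hj hIj => by
    rwa [Function.update_of_ne (by rintro rfl; exact hv (h.groups_subset _ hj))] at hIj
  le_val W Y hWY := by
    have hvW : v ∉ W := fun hvW => hWY.allowed v hvW hJv
    refine h.le_val W Y { hWY.update (b := 2) (by simp) (by simp) with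
      subset := fun j hj => ?_ }
    exact Finset.mem_of_mem_insert_of_ne (hWY.subset hj) (by rintro rfl; exact hvW hj)

theorem tableCorrect_extend {G K : ℕ} (hv : v ∉ S) (hBS : ∀ j ∈ B, j ∈ S)
    (hB : ∀ j ∈ S, 𝔊.groupGraph.Adj v j → j ∈ B) (hF : 𝔊.TableCorrect x G K S B F) :
    𝔊.TableCorrect x G K (insert v S) (v :: B) (𝔊.extend c x G K B F v).ret := by
  refine tableCorrect_fillTable fun J hJ g hg₁ hg k hk₁ hk => ?_
  have hI := update_two_mem_assignments (fun hvB => hv (hBS v hvB)) hJ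
  split_ifs with hJv
  · exact (hF _ hI g hg k hk).insert_of_forbidden hv hJv
  · have hJv2 : J v ≠ 2 := (mem_assignments.1 hJ v).2 List.mem_cons_self
    exact isBest_accept hv hB hI (by omega) hg₁ hk₁ fun l _ =>
      hF _ hI (g - 1) (by omega) (k - l) (by omega)

end Acceptance

end GroupStructure

theorem foldl_update_apply {α β : Type*} [DecidableEq α] (p : α → Bool) (h : β → β) {l : List α}
    (hl : l.Nodup) (r : α → β) (u : α) :
    l.foldl (fun r u => if p u then Function.update r u (h (r u)) else r) r u =
      if u ∈ l ∧ p u then h (r u) else r u := by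
  induction l generalizing r with
  | nil => simp
  | cons a l ih =>
    obtain ⟨ha, hl⟩ := List.nodup_cons.1 hl
    rw [List.foldl_cons, ih hl]
    rcases eq_or_ne u a with rfl | hua
    · cases hp : p u <;> simp [ha]
    · cases hp : p a <;> simp [hua]

namespace GroupStructure

open Timed

variable {N M : ℕ} {𝔊 : GroupStructure N M} {x : Fin N → ℝ} {c : CostModel} {G K : ℕ}
  {S : Finset (Fin M)} {v : Fin M}

open Classical in
/-- The unexplored neighbours of a node, which `DPState.unexplored` counts. -/
noncomputable def unexploredNeighbors (𝔊 : GroupStructure N M) (S : Finset (Fin M)) (u : Fin M) :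
    Finset (Fin M) :=
  Finset.univ.filter fun w => w ∉ S ∧ 𝔊.groupGraph.Adj u w

theorem mem_unexploredNeighbors {u w : Fin M} :
    w ∈ 𝔊.unexploredNeighbors S u ↔ w ∉ S ∧ 𝔊.groupGraph.Adj u w := by
  simp [unexploredNeighbors]

theorem card_unexploredNeighbors_insert (hv : v ∉ S) (u : Fin M) :
    (𝔊.unexploredNeighbors (insert v S) u).card =
      if (𝔊.adjacent v u).ret then (𝔊.unexploredNeighbors S u).card - 1
      else (𝔊.unexploredNeighbors S u).card := by
  have herase : 𝔊.unexploredNeighbors (insert v S) u = (𝔊.unexploredNeighbors S u).erase v := by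
    ext w
    simp only [Finset.mem_erase, mem_unexploredNeighbors, Finset.mem_insert]
    tauto
  have hmem : v ∈ 𝔊.unexploredNeighbors S u ↔ (𝔊.adjacent v u).ret = true := by
    rw [mem_unexploredNeighbors, ret_adjacent, 𝔊.groupGraph.adj_comm]
    exact and_iff_right hv
  simp only [herase, Finset.card_erase_eq_ite, hmem]

theorem mem_boundary_iff_nonempty {u : Fin M} :
    u ∈ 𝔊.boundary S ↔ u ∈ S ∧ (𝔊.unexploredNeighbors S u).Nonempty := by
  simp only [mem_boundary, Finset.Nonempty, mem_unexploredNeighbors]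

theorem mem_boundary_insert {u : Fin M} :
    u ∈ 𝔊.boundary (insert v S) ↔
      (u = v ∨ u ∈ 𝔊.boundary S) ∧ (𝔊.unexploredNeighbors (insert v S) u).Nonempty := by
  have hmono : (𝔊.unexploredNeighbors (insert v S) u).Nonempty →
      (𝔊.unexploredNeighbors S u).Nonempty := by
    refine Finset.Nonempty.mono fun w hw => ?_
    simp only [mem_unexploredNeighbors, Finset.mem_insert] at hw ⊢
    tauto
  simp only [mem_boundary_iff_nonempty, Finset.mem_insert]
  tauto

section UpdateNeighbors

/-- Apply `h` to the counters of the neighbours of `v`: the loop shared by the initialization, which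
increments the counters, and by the exploration of a node, which decrements them. -/
def updateNeighbors (𝔊 : GroupStructure N M) (c : CostModel) (h : ℕ → ℕ) (r : Fin M → ℕ)
    (v : Fin M) : Timed (Fin M → ℕ) :=
  Timed.foldl (fun r u => do
    let b ← c.charge (𝔊.adjacent v u)
    pure (if b then Function.update r u (h (r u)) else r)) r (List.finRange M)

theorem ret_updateNeighbors_apply (h : ℕ → ℕ) (r : Fin M → ℕ) (u : Fin M) :
    (𝔊.updateNeighbors c h r v).ret u = if (𝔊.adjacent v u).ret then h (r u) else r u := by
  simp only [updateNeighbors, ret_foldl, ret_bind, ret_pure, CostModel.ret_charge]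
  rw [foldl_update_apply (fun u => (𝔊.adjacent v u).ret) h (List.nodup_finRange M)]
  simp only [List.mem_finRange, true_and]

theorem ret_foldl_updateNeighbors_succ (r : Fin M → ℕ) (l : List (Fin M)) (u : Fin M) :
    (Timed.foldl (𝔊.updateNeighbors c (· + 1)) r l).ret u =
      r u + l.countP fun v => (𝔊.adjacent v u).ret := by
  induction l using List.reverseRecOn with
  | nil => simp [Timed.foldl]
  | append_singleton l v ih =>
    rw [ret_foldl_concat, ret_updateNeighbors_apply, ih, List.countP_append,
      List.countP_singleton]
    split_ifs <;> rfl

end UpdateNeighbors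

/-- The state of the dynamic program after the nodes of `S` have been explored. -/
structure StateCorrect (𝔊 : GroupStructure N M) (x : Fin N → ℝ) (G K : ℕ) (S : Finset (Fin M))
    (s : DPState N M) : Prop where
  unexplored_eq : ∀ u, s.unexplored u = (𝔊.unexploredNeighbors S u).card
  nodup_bdry : s.bdry.Nodup
  mem_bdry : ∀ j, j ∈ s.bdry ↔ j ∈ 𝔊.boundary S
  table : 𝔊.TableCorrect x G K S s.bdry s.table

section Exploration

variable {s : DPState N M}

theorem StateCorrect.length_bdry (hs : 𝔊.StateCorrect x G K S s) :
    s.bdry.length = (𝔊.boundary S).card := by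
  rw [← List.toFinset_card_of_nodup hs.nodup_bdry]
  congr 1
  ext j
  rw [List.mem_toFinset, hs.mem_bdry]

theorem StateCorrect.nodup_cons_bdry (hs : 𝔊.StateCorrect x G K S s) (hv : v ∉ S) :
    (v :: s.bdry).Nodup :=
  List.nodup_cons.2 ⟨fun h => hv (mem_boundary.1 ((hs.mem_bdry v).1 h)).1, hs.nodup_bdry⟩

theorem ret_foldl_condense_fst (s : List (Fin M) × Table N M) (l : List (Fin M)) :
    (Timed.foldl (condense G K) s l).ret.1 = s.1.diff l := by
  induction l generalizing s with
  | nil => rfl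
  | cons a l ih =>
    rw [List.diff_cons]
    exact ih _

theorem tableCorrect_foldl_condense {s : List (Fin M) × Table N M} (hs : s.1.Nodup)
    {l : List (Fin M)} (hl : l.Nodup) (hls : l ⊆ s.1) (hF : 𝔊.TableCorrect x G K S s.1 s.2) :
    𝔊.TableCorrect x G K S (Timed.foldl (condense G K) s l).ret.1
      (Timed.foldl (condense G K) s l).ret.2 := by
  induction l generalizing s with
  | nil => exact hF
  | cons a l ih =>
    obtain ⟨ha, hl⟩ := List.nodup_cons.1 hl
    obtain ⟨has, hls⟩ := List.cons_subset.1 hls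
    exact ih (s := (condense G K s a).ret) (hs.erase a) hl
      (fun j hj => (List.mem_erase_of_ne (by rintro rfl; exact ha hj)).2 (hls hj))
      (tableCorrect_condense hs has hF)

theorem ret_explore_unexplored :
    (𝔊.explore c x G K s v).ret.unexplored =
      (𝔊.updateNeighbors c (· - 1) s.unexplored v).ret := rfl

/-- The nodes that have fallen into the interior of the explored nodes after `v` has been explored:
those that `explore` condenses. -/
noncomputable def interior (𝔊 : GroupStructure N M) (c : CostModel) (s : DPState N M)
    (v : Fin M) : List (Fin M) :=
  (v :: s.bdry).filter fun j => (𝔊.updateNeighbors c (· - 1) s.unexplored v).ret j = 0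

theorem ret_filter_interior :
    (Timed.filter (fun j => pure (decide
      ((𝔊.updateNeighbors c (· - 1) s.unexplored v).ret j = 0))) (v :: s.bdry)).ret =
      𝔊.interior c s v :=
  ret_filter _ _

theorem ret_explore_table :
    ((𝔊.explore c x G K s v).ret.bdry, (𝔊.explore c x G K s v).ret.table) =
      (Timed.foldl (condense G K) (v :: s.bdry, (𝔊.extend c x G K s.bdry s.table v).ret)
        (𝔊.interior c s v)).ret := by
  rw [← ret_filter_interior]
  rfl

theorem ret_explore_bdry (hnodup : (v :: s.bdry).Nodup) :
    (𝔊.explore c x G K s v).ret.bdry =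
      (v :: s.bdry).filter fun j => (𝔊.explore c x G K s v).ret.unexplored j ≠ 0 := by
  have hfst := congrArg Prod.fst (ret_explore_table (𝔊 := 𝔊) (c := c) (x := x) (G := G) (K := K)
    (s := s) (v := v))
  rw [ret_foldl_condense_fst, hnodup.sdiff_eq_filter] at hfst
  rw [ret_explore_unexplored]
  refine hfst.trans (List.filter_congr fun j hj => ?_)
  simp [interior, List.mem_filter, List.mem_cons.1 hj]

theorem StateCorrect.explore (hs : 𝔊.StateCorrect x G K S s) (hv : v ∉ S) :
    𝔊.StateCorrect x G K (insert v S) (𝔊.explore c x G K s v).ret := by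
  have hnodup := hs.nodup_cons_bdry hv
  have hunexplored : ∀ u, (𝔊.explore c x G K s v).ret.unexplored u =
      (𝔊.unexploredNeighbors (insert v S) u).card := fun u => by
    rw [ret_explore_unexplored, ret_updateNeighbors_apply, card_unexploredNeighbors_insert hv,
      hs.unexplored_eq]
  refine ⟨hunexplored, ?_, fun j => ?_, ?_⟩
  · rw [ret_explore_bdry hnodup]
    exact hnodup.filter _
  · rw [ret_explore_bdry hnodup, List.mem_filter, List.mem_cons, hs.mem_bdry,
      decide_eq_true_iff, hunexplored, mem_boundary_insert, Finset.card_ne_zero]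
  · have hextend := tableCorrect_extend (c := c) hv
      (fun j hj => (mem_boundary.1 ((hs.mem_bdry j).1 hj)).1)
      (fun j hj hvj => (hs.mem_bdry j).2 (mem_boundary.2 ⟨hj, v, hv, hvj.symm⟩)) hs.table
    have hcondense := tableCorrect_foldl_condense
      (s := (v :: s.bdry, (𝔊.extend c x G K s.bdry s.table v).ret)) (l := 𝔊.interior c s v)
      hnodup (hnodup.filter _) (List.filter_subset_self _) hextend
    rw [← ret_explore_table] at hcondense
    exact hcondense

theorem ret_initialState : (𝔊.initialState c G K).ret =
    ⟨(Timed.foldl (𝔊.updateNeighbors c (· + 1)) (fun _ => 0) (List.finRange M)).ret, [],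
      (fillTable G K [] fun _ _ _ => pure emptyEntry).ret⟩ :=
  rfl

theorem stateCorrect_initialState :
    𝔊.StateCorrect x G K ∅ (𝔊.initialState c G K).ret := by
  have htable : 𝔊.TableCorrect x G K ∅ [] (fillTable G K [] fun _ _ _ => pure emptyEntry).ret :=
    tableCorrect_fillTable fun I _ g _ _ k _ _ => isBest_emptyEntry (Or.inl rfl)
  rw [ret_initialState]
  refine ⟨fun u => ?_, List.nodup_nil, fun j => by simp [mem_boundary], htable⟩
  refine (ret_foldl_updateNeighbors_succ _ _ u).trans ?_
  rw [zero_add, List.countP_eq_length_filter,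
    ← List.toFinset_card_of_nodup ((List.nodup_finRange M).filter _)]
  congr 1
  ext w
  simp [mem_unexploredNeighbors, 𝔊.groupGraph.adj_comm]

theorem stateCorrect_foldl_explore {l : List (Fin M)} (hl : l.Nodup) :
    𝔊.StateCorrect x G K l.toFinset
      (Timed.foldl (𝔊.explore c x G K) (𝔊.initialState c G K).ret l).ret := by
  induction l using List.reverseRecOn with
  | nil => exact stateCorrect_initialState
  | append_singleton l v ih =>
    obtain ⟨hv, hl⟩ := (List.nodup_concat l v).1 (List.concat_eq_append ▸ hl)
    rw [ret_foldl_concat]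
    have hinsert : (l ++ [v]).toFinset = insert v l.toFinset := by
      ext u
      simp
    rw [hinsert]
    exact (ih hl).explore (by simpa using hv)

end Exploration

end GroupStructure

section Binary

theorem sum_binary_mul {n : ℕ} {R : Type*} [NonAssocSemiring R] (y : Fin n → Fin 2)
    (w : Fin n → R) : ∑ i, ((y i : ℕ) : R) * w i = ∑ i with y i = 1, w i := by
  rw [Finset.sum_filter]
  refine Finset.sum_congr rfl fun i _ => ?_
  rcases Fin.exists_fin_two.1 ⟨y i, rfl⟩ with h | h <;> simp [h]

theorem sum_binary {n : ℕ} (y : Fin n → Fin 2) :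
    ∑ i, (y i : ℕ) = (Finset.univ.filter fun i => y i = 1).card := by
  simpa using sum_binary_mul y fun _ => (1 : ℕ)

theorem listIndicator_eq_one {n : ℕ} {l : List (Fin n)} {i : Fin n} :
    listIndicator l i = 1 ↔ i ∈ l := by
  simp [listIndicator]

theorem filter_listIndicator_eq_one {n : ℕ} (l : List (Fin n)) :
    (Finset.univ.filter fun i => listIndicator l i = 1) = l.toFinset := by
  ext i
  simp [listIndicator_eq_one]

theorem sum_listIndicator_le {n : ℕ} (l : List (Fin n)) :
    ∑ i, (listIndicator l i : ℕ) ≤ l.length := by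
  rw [sum_binary, filter_listIndicator_eq_one]
  exact l.toFinset_card_le

end Binary

namespace GroupStructure

variable {N M : ℕ} {𝔊 : GroupStructure N M} {x : Fin N → ℝ} {G K : ℕ}

section Optimality

variable {ω : Fin M → Fin 2} {y : Fin N → Fin 2}

theorem objective_eq_sum (y : Fin N → Fin 2) : objective x y = ∑ i with y i = 1, x i ^ 2 :=
  sum_binary_mul y _

theorem objective_listIndicator {l : List (Fin N)} (hl : l.Nodup) :
    objective x (listIndicator l) = (l.map fun i => x i ^ 2).sum := by
  rw [objective_eq_sum, filter_listIndicator_eq_one, List.sum_toFinset _ hl]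

theorem biadjacency_mulVec_pos {i : Fin N} :
    0 < (𝔊.biadjacency.mulVec fun j => (ω j : ℕ)) i ↔ ∃ j, ω j = 1 ∧ i ∈ 𝔊.group j := by
  have hsum : (𝔊.biadjacency.mulVec fun j => (ω j : ℕ)) i =
      ∑ j with ω j = 1, if i ∈ 𝔊.group j then 1 else 0 := by
    rw [← sum_binary_mul]
    simp [Matrix.mulVec, dotProduct, biadjacency]
  simp [hsum, Finset.Nonempty]

theorem feasible_iff : 𝔊.Feasible G K ω y ↔
    (∀ i, y i = 1 → ∃ j, ω j = 1 ∧ i ∈ 𝔊.group j) ∧ ∑ i, (y i : ℕ) ≤ K ∧ ∑ j, (ω j : ℕ) ≤ G := by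
  have hcovered : ∀ i, (y i : ℕ) ≤ (𝔊.biadjacency.mulVec fun j => (ω j : ℕ)) i ↔
      (y i = 1 → ∃ j, ω j = 1 ∧ i ∈ 𝔊.group j) := fun i => by
    rw [← biadjacency_mulVec_pos]
    rcases Fin.exists_fin_two.1 ⟨y i, rfl⟩ with h | h <;> simp [h, Nat.one_le_iff_ne_zero,
      Nat.pos_iff_ne_zero]
  simp only [← hcovered]
  exact ⟨fun h => ⟨h.covered, h.sparse, h.groupSparse⟩, fun h => ⟨h.1, h.2.1, h.2.2⟩⟩

-- An inclusion-minimal subfamily of the chosen groups that still covers the chosen elements has no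
-- redundant group.
theorem Feasible.exists_isCompetitor (h : 𝔊.Feasible G K ω y) :
    ∃ W, 𝔊.IsCompetitor Finset.univ (fun _ => 2) G K W (Finset.univ.filter fun i => y i = 1) := by
  obtain ⟨hcov, hsparse, hgroupSparse⟩ := feasible_iff.1 h
  set Y := Finset.univ.filter fun i => y i = 1
  set Ω := Finset.univ.filter fun j => ω j = 1
  have hΩ : ∀ i ∈ Y, ∃ j ∈ Ω, i ∈ 𝔊.group j := by simpa [Y, Ω] using hcov
  obtain ⟨W, hWΩ, hW⟩ := exists_minimal_le_of_wellFoundedLT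
    (fun W : Finset (Fin M) => ∀ i ∈ Y, ∃ j ∈ W, i ∈ 𝔊.group j) Ω hΩ
  refine ⟨W, Finset.subset_univ W, ?_, ?_, hW.prop, fun j hj => ?_, by simp, by simp⟩
  · exact (Finset.card_le_card hWΩ).trans ((sum_binary ω).symm.trans_le hgroupSparse)
  · exact (sum_binary y).symm.trans_le hsparse
  · by_contra hredundant
    have hcovErase : ∀ i ∈ Y, ∃ j' ∈ W.erase j, i ∈ 𝔊.group j' := fun i hi => by
      have hi' : i ∉ 𝔊.privateElems W Y j := fun hi' => hredundant ⟨i, hi'⟩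
      simp only [mem_privateElems, not_and, not_forall] at hi'
      obtain ⟨j', hj', hij', hne⟩ := hi' hi
      exact ⟨j', Finset.mem_erase.2 ⟨hne, hj'⟩, hij'⟩
    exact Finset.notMem_erase j W (hW.le_of_le hcovErase (Finset.erase_subset j W) hj)

theorem IsBest.val_eq_objective {S : Finset (Fin M)} {I : Assignment M} {e : Entry N M}
    (h : 𝔊.IsBest x S I G K e) : e.val = objective x (listIndicator e.batches.flatten) := by
  rw [objective_listIndicator h.elems_nodup, h.val_eq]

theorem IsBest.isOptimal {e : Entry N M} (h : 𝔊.IsBest x Finset.univ (fun _ => 2) G K e) :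
    𝔊.IsOptimal x G K (listIndicator e.groups) (listIndicator e.batches.flatten) := by
  refine ⟨feasible_iff.2 ⟨fun i hi => ?_, ?_, ?_⟩, fun ω₁ y₁ h₁ => ?_⟩
  · simpa only [listIndicator_eq_one] using h.elems_covered i (listIndicator_eq_one.1 hi)
  · exact (sum_listIndicator_le _).trans h.elems_length_le
  · exact (sum_listIndicator_le _).trans h.groups_length_le
  · obtain ⟨W, hW⟩ := h₁.exists_isCompetitor
    rw [← h.val_eq_objective, objective_eq_sum]
    exact h.le_val W _ hW

end Optimality

section DynamicProgram

variable {c : CostModel} {root : Equiv.Perm (Fin M)}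

/-- The state of the dynamic program after all nodes have been explored. -/
noncomputable def finalState (𝔊 : GroupStructure N M) (c : CostModel) (x : Fin N → ℝ) (G K : ℕ)
    (root : Equiv.Perm (Fin M)) : DPState N M :=
  (Timed.foldl (𝔊.explore c x G K) (𝔊.initialState c G K).ret (𝔊.nodeOrder c root).ret).ret

/-- The entry for the full budgets, from which the dynamic program reads off its result. -/
noncomputable def finalEntry (𝔊 : GroupStructure N M) (c : CostModel) (x : Fin N → ℝ) (G K : ℕ)
    (root : Equiv.Perm (Fin M)) : Entry N M :=
  (readEntry (𝔊.finalState c x G K root).table (fun _ => 2) G K).ret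

theorem ret_dynamicProgram :
    (𝔊.dynamicProgram c x G K root).ret =
      ⟨(𝔊.finalEntry c x G K root).val, (𝔊.finalEntry c x G K root).groups,
        (𝔊.finalEntry c x G K root).batches.flatten⟩ := rfl

theorem isBest_finalEntry (hG : 𝔊.groupGraph.IsAcyclic) :
    𝔊.IsBest x Finset.univ (fun _ => 2) G K (𝔊.finalEntry c x G K root) := by
  have hstate := stateCorrect_foldl_explore (𝔊 := 𝔊) (x := x) (c := c) (G := G) (K := K)
    (nodup_nodeOrder (c := c) hG root)
  have huniv : (𝔊.nodeOrder c root).ret.toFinset = Finset.univ := by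
    ext v
    simp [mem_nodeOrder hG root v]
  rw [huniv] at hstate
  have hunrestricted : (fun _ => 2) ∈ assignments (𝔊.finalState c x G K root).bdry :=
    mem_assignments.2 fun j => by
      simp only [ne_eq, not_true_eq_false, false_iff]
      intro hj
      simpa [mem_boundary] using (hstate.mem_bdry j).1 hj
  exact hstate.table _ hunrestricted G le_rfl K le_rfl

theorem isOptimal_dynamicProgram (hG : 𝔊.groupGraph.IsAcyclic) :
    𝔊.IsOptimal x G K (listIndicator (𝔊.dynamicProgram c x G K root).ret.groups)
      (listIndicator (𝔊.dynamicProgram c x G K root).ret.elems) := by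
  rw [ret_dynamicProgram]
  exact (isBest_finalEntry hG).isOptimal

theorem ret_dynamicProgram_val (hG : 𝔊.groupGraph.IsAcyclic) :
    (𝔊.dynamicProgram c x G K root).ret.val =
      objective x (listIndicator (𝔊.dynamicProgram c x G K root).ret.elems) := by
  rw [ret_dynamicProgram]
  exact (isBest_finalEntry hG).val_eq_objective

end DynamicProgram

end GroupStructure

namespace GroupStructure

open Timed

variable {N M : ℕ} {𝔊 : GroupStructure N M} {x : Fin N → ℝ} {G K : ℕ} {c : CostModel}

/-- The cost model charges at most `Q` steps for an overlap test and for cleaning a group together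
with looking up its heaviest elements; both parts of the running time analysis are instances. -/
structure SubroutineBound (𝔊 : GroupStructure N M) (x : Fin N → ℝ) (c : CostModel) (Q : ℕ) :
    Prop where
  one_le : 1 ≤ Q
  adjacent_le : ∀ i j, (c.charge (𝔊.adjacent i j)).time ≤ Q
  heaviest_le : ∀ B : List (Fin M), B.length ≤ M → ∀ I v l,
    (c.charge (𝔊.heaviest x B I v l)).time ≤ Q

section Subroutines

theorem subroutineBound_unit : 𝔊.SubroutineBound x .unit 1 where
  one_le := le_rfl
  adjacent_le _ _ := le_rfl
  heaviest_le _ _ _ _ _ := le_rfl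

theorem time_heaviest_le {B : List (Fin M)} (hB : B.length ≤ M) (I : Assignment M) (v : Fin M)
    (l : ℕ) : (𝔊.heaviest x B I v l).time ≤ (M + N + 1) ^ 2 := by
  have hclean : (𝔊.cleaned B I v).time ≤ N * (M + 2) := by
    refine (time_filter_le (c := M + 1) fun i _ => ?_).trans_eq (by rw [List.length_finRange])
    simpa using hB
  have hlength : (𝔊.cleaned B I v).ret.length ≤ N := by
    simpa using (nodup_cleaned (𝔊 := 𝔊) (B := B) (I := I) (v := v)).length_le_card
  have hsort := (time_sortDesc_le (fun i => x i ^ 2) (𝔊.cleaned B I v).ret).trans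
    (Nat.mul_le_mul hlength hlength)
  have htake : ((sortDesc (fun i => x i ^ 2) (𝔊.cleaned B I v).ret).ret.take l).length ≤ N := by
    rw [List.length_take, (sortDesc_perm _ _).length_eq]
    exact (min_le_right _ _).trans hlength
  have hM : N ≤ N * M := Nat.le_mul_of_pos_right _ v.pos
  simp only [heaviest, time_bind, time_tick, time_pure]
  nlinarith

theorem subroutineBound_elementary : 𝔊.SubroutineBound x .elementary ((M + N + 1) ^ 2) where
  one_le := Nat.one_le_pow _ _ (Nat.succ_pos _)
  adjacent_le i j := by
    have hscan : N + 1 ≤ (M + N + 1) ^ 2 :=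
      (by omega : N + 1 ≤ M + N + 1).trans (Nat.le_self_pow two_ne_zero _)
    simpa [CostModel.charge, adjacent] using hscan
  heaviest_le _ hB I v l := time_heaviest_le hB I v l

end Subroutines

theorem SubroutineBound.mul_le {Q : ℕ} (hQ : 𝔊.SubroutineBound x c Q) (hK : 1 ≤ K) :
    G * K ≤ G * K ^ 2 * Q := by
  rw [show G * K ^ 2 * Q = G * K * (K * Q) by ring]
  exact Nat.le_mul_of_pos_right _ (Nat.mul_pos hK hQ.one_le)

section Tables

variable {Q : ℕ} {B : List (Fin M)} {F : Table N M} {v : Fin M}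

theorem time_fillTable_le {f : Assignment M → ℕ → ℕ → Timed (Entry N M)} {t : ℕ}
    (hG : 1 ≤ G) (hK : 1 ≤ K) (hf : ∀ I g, ∀ k ≤ K, (f I g k).time ≤ t) :
    (fillTable G K B f).time ≤ 2 ^ B.length * (G * K * (t + 4)) := by
  have hassignment : (fillTable G K B f).time ≤
      (assignments B).length * (G * (K * (t + 1 + 1) + 1) + 1) := by
    refine time_foldl_le (fun F I _ => ?_) _
    refine (time_foldl_le (c := K * (t + 1 + 1)) (fun F g _ => ?_) _).trans_eq (by simp)
    refine (time_foldl_le (c := t + 1) (fun F k hk => ?_) _).trans_eq (by simp)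
    rw [List.mem_range'_1] at hk
    simpa [writeEntry] using hf I g k (by omega)
  rw [length_assignments] at hassignment
  refine hassignment.trans (Nat.mul_le_mul_left _ ?_)
  have hGK : G ≤ G * K := Nat.le_mul_of_pos_right _ hK
  nlinarith [Nat.mul_pos hG hK]

theorem SubroutineBound.time_candidate_le (hQ : 𝔊.SubroutineBound x c Q) (hB : B.length ≤ M)
    (I : Assignment M) (g k l : ℕ) : (𝔊.candidate c x B F v I g k l).time ≤ Q + 2 := by
  have hheaviest := hQ.heaviest_le B hB I v l
  simp only [candidate, readEntry, time_bind, time_tick, time_pure]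
  omega

theorem SubroutineBound.time_accept_le (hQ : 𝔊.SubroutineBound x c Q) (hB : B.length ≤ M)
    (I : Assignment M) (g : ℕ) {k : ℕ} (hk : k ≤ K) (hK : 1 ≤ K) :
    (𝔊.accept c x B F v I g k).time ≤ K * (Q + 4) := by
  have hfirst := hQ.time_candidate_le (F := F) (v := v) hB I g k 1
  have hothers : (Timed.foldl (fun a l => do
      let b ← 𝔊.candidate c x B F v I g k l
      better a b) (𝔊.candidate c x B F v I g k 1).ret (List.range' 2 (k - 1))).time ≤
      (k - 1) * (Q + 3 + 1) := by
    refine (time_foldl_le (c := Q + 3) (fun a l _ => ?_) _).trans_eq (by simp)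
    have hcandidate := hQ.time_candidate_le (F := F) (v := v) hB I g k l
    simp only [better, time_bind, time_tick, time_pure]
    omega
  obtain ⟨n, rfl⟩ := Nat.exists_eq_add_of_le' hK
  have hcount : (k - 1) * (Q + 3 + 1) ≤ n * (Q + 4) := Nat.mul_le_mul_right _ (by omega)
  simp only [accept, time_bind]
  linarith

theorem SubroutineBound.time_extend_le (hQ : 𝔊.SubroutineBound x c Q) (hB : B.length ≤ M)
    (hG : 1 ≤ G) (hK : 1 ≤ K) :
    (𝔊.extend c x G K B F v).time ≤ 2 ^ (B.length + 1) * (9 * (G * K ^ 2 * Q)) := by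
  have hKQ : 1 ≤ K * Q := Nat.mul_pos hK hQ.one_le
  have hentry : (𝔊.extend c x G K B F v).time ≤
      2 ^ (B.length + 1) * (G * K * (K * (Q + 4) + 4)) := by
    refine time_fillTable_le hG hK fun J g k hk => ?_
    split_ifs
    · simp only [readEntry, time_bind, time_tick, time_pure]
      nlinarith
    · exact hQ.time_accept_le hB _ g hk hK
  have hK' : K ≤ K * Q := Nat.le_mul_of_pos_right _ hQ.one_le
  calc (𝔊.extend c x G K B F v).time
      ≤ 2 ^ (B.length + 1) * (G * K * (K * (Q + 4) + 4)) := hentry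
    _ ≤ 2 ^ (B.length + 1) * (G * K * (9 * (K * Q))) := by gcongr; linarith
    _ = 2 ^ (B.length + 1) * (9 * (G * K ^ 2 * Q)) := by ring

theorem time_condense_le (hG : 1 ≤ G) (hK : 1 ≤ K) {s : List (Fin M) × Table N M} {b : ℕ}
    (hs : s.1.length ≤ b) (j : Fin M) :
    (condense G K s j).time ≤ b + 2 ^ b * (G * K * 7) := by
  have hfill : (fillTable G K (s.1.erase j) fun I g k => do
      let a ← readEntry s.2 (Function.update I j 0) g k
      let b ← readEntry s.2 (Function.update I j 1) g k
      better a b).time ≤ 2 ^ (s.1.erase j).length * (G * K * (3 + 4)) :=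
    time_fillTable_le hG hK fun I g k _ => by simp [readEntry, better]
  have hpow : 2 ^ (s.1.erase j).length ≤ 2 ^ b :=
    Nat.pow_le_pow_right two_pos (List.length_erase_le.trans hs)
  simp only [condense, time_bind, time_tick, time_pure]
  exact Nat.add_le_add hs (hfill.trans (Nat.mul_le_mul_right _ hpow))

theorem time_foldl_condense_le (hG : 1 ≤ G) (hK : 1 ≤ K) {b : ℕ} (l : List (Fin M))
    {s : List (Fin M) × Table N M} (hs : s.1.length ≤ b) :
    (Timed.foldl (condense G K) s l).time ≤ l.length * (2 ^ b * (8 * (G * K))) := by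
  induction l generalizing s with
  | nil => exact Nat.zero_le _
  | cons j l ih =>
    have hhead := time_condense_le hG hK hs j
    have htail := ih (s := (condense G K s j).ret) (List.length_erase_le.trans hs)
    have hpow : b + 1 ≤ 2 ^ b * (G * K) :=
      Nat.lt_two_pow_self.trans_le (Nat.le_mul_of_pos_right _ (Nat.mul_pos hG hK))
    simp only [Timed.foldl, time_bind, time_tick, List.length_cons]
    linarith

end Tables

section Exploration

variable {Q : ℕ} {S : Finset (Fin M)} {s : DPState N M} {v : Fin M}

theorem time_updateNeighbors_le {a : ℕ} (ha : ∀ i j, (c.charge (𝔊.adjacent i j)).time ≤ a)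
    (h : ℕ → ℕ) (r : Fin M → ℕ) : (𝔊.updateNeighbors c h r v).time ≤ M * (a + 1) :=
  (time_foldl_le (c := a) (fun r u _ => by simpa using ha v u) r).trans_eq
    (by rw [List.length_finRange])

theorem time_initialState_le {a : ℕ} (ha : ∀ i j, (c.charge (𝔊.adjacent i j)).time ≤ a)
    (hG : 1 ≤ G) (hK : 1 ≤ K) :
    (𝔊.initialState c G K).time ≤ M * (M * (a + 1) + 1) + G * K * 4 := by
  have hcount : (Timed.foldl (𝔊.updateNeighbors c (· + 1)) (fun _ => 0)
      (List.finRange M)).time ≤ M * (M * (a + 1) + 1) :=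
    (time_foldl_le (fun r v _ => time_updateNeighbors_le ha _ r) _).trans_eq
      (by rw [List.length_finRange])
  have hfill : (fillTable G K ([] : List (Fin M)) fun _ _ _ =>
      pure (emptyEntry : Entry N M)).time ≤ 2 ^ 0 * (G * K * (0 + 4)) :=
    time_fillTable_le hG hK fun _ _ _ _ => le_rfl
  rw [pow_zero, one_mul, zero_add] at hfill
  exact Nat.add_le_add hcount hfill

theorem time_explore :
    (𝔊.explore c x G K s v).time = (𝔊.updateNeighbors c (· - 1) s.unexplored v).time +
      ((𝔊.extend c x G K s.bdry s.table v).time + ((Timed.filter (fun j => pure (decide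
        ((𝔊.updateNeighbors c (· - 1) s.unexplored v).ret j = 0))) (v :: s.bdry)).time +
      (Timed.foldl (condense G K) (v :: s.bdry, (𝔊.extend c x G K s.bdry s.table v).ret)
        (𝔊.interior c s v)).time)) := by
  rw [← ret_filter_interior]
  rfl

theorem length_interior_add_length_bdry (hnodup : (v :: s.bdry).Nodup) :
    (𝔊.interior c s v).length + (𝔊.explore c x G K s v).ret.bdry.length = s.bdry.length + 1 := by
  rw [ret_explore_bdry hnodup, ret_explore_unexplored, interior, ← List.length_cons (a := v),
    List.length_eq_length_filter_add (l := v :: s.bdry) fun j => decide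
      ((𝔊.updateNeighbors c (· - 1) s.unexplored v).ret j = 0)]
  simp only [ne_eq, decide_not]

-- The potential `|∂|` pays for the condensations: a node enters the boundary list only once.
theorem StateCorrect.time_explore_le (hs : 𝔊.StateCorrect x G K S s) (hv : v ∉ S)
    (hQ : 𝔊.SubroutineBound x c Q) (hG : 1 ≤ G) (hK : 1 ≤ K)
    (hS : 2 ^ (𝔊.boundary S).card ≤ M + 1) :
    (𝔊.explore c x G K s v).time +
        32 * (M * (G * K ^ 2 * Q)) * (𝔊.explore c x G K s v).ret.bdry.length ≤
      71 * (M * (G * K ^ 2 * Q)) + 32 * (M * (G * K ^ 2 * Q)) * s.bdry.length := by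
  have hnodup := hs.nodup_cons_bdry hv
  have hlength : s.bdry.length + 1 ≤ M := by simpa using hnodup.length_le_card
  have hpow : 2 ^ (s.bdry.length + 1) ≤ 4 * M := by
    rw [pow_succ, hs.length_bdry]
    omega
  have hMQ : M * Q ≤ M * (G * K ^ 2 * Q) :=
    Nat.mul_le_mul_left _ (Nat.le_mul_of_pos_left _ (by positivity))
  have hM : M ≤ M * Q := Nat.le_mul_of_pos_right _ hQ.one_le
  have hupdate := time_updateNeighbors_le (v := v) hQ.adjacent_le (· - 1) s.unexplored
  have hextend : (𝔊.extend c x G K s.bdry s.table v).time ≤ 36 * (M * (G * K ^ 2 * Q)) :=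
    calc _ ≤ 2 ^ (s.bdry.length + 1) * (9 * (G * K ^ 2 * Q)) :=
          hQ.time_extend_le (by omega) hG hK
      _ ≤ 4 * M * (9 * (G * K ^ 2 * Q)) := Nat.mul_le_mul_right _ hpow
      _ = 36 * (M * (G * K ^ 2 * Q)) := by ring
  have hfilter : (Timed.filter (fun j => pure (decide
      ((𝔊.updateNeighbors c (· - 1) s.unexplored v).ret j = 0))) (v :: s.bdry)).time ≤ M :=
    (time_filter_le (c := 0) fun _ _ => le_rfl).trans (by simpa using hlength)
  have hcondense : (Timed.foldl (condense G K)
      (v :: s.bdry, (𝔊.extend c x G K s.bdry s.table v).ret) (𝔊.interior c s v)).time ≤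
      32 * (M * (G * K ^ 2 * Q)) * (𝔊.interior c s v).length :=
    calc _ ≤ (𝔊.interior c s v).length * (2 ^ (s.bdry.length + 1) * (8 * (G * K))) :=
          time_foldl_condense_le hG hK _ le_rfl
      _ ≤ (𝔊.interior c s v).length * (4 * M * (8 * (G * K ^ 2 * Q))) :=
          Nat.mul_le_mul_left _ (Nat.mul_le_mul hpow (Nat.mul_le_mul_left _ (hQ.mul_le hK)))
      _ = 32 * (M * (G * K ^ 2 * Q)) * (𝔊.interior c s v).length := by ring
  have hpotential := congrArg (32 * (M * (G * K ^ 2 * Q)) * ·)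
    (length_interior_add_length_bdry (𝔊 := 𝔊) (c := c) (x := x) (G := G) (K := K) hnodup)
  simp only [mul_add] at hpotential
  rw [time_explore]
  linarith

theorem time_foldl_explore_le {l : List (Fin M)} (hl : l.Nodup)
    (hbdry : ∀ m, 2 ^ (𝔊.boundary (l.take m).toFinset).card ≤ M + 1)
    (hQ : 𝔊.SubroutineBound x c Q) (hG : 1 ≤ G) (hK : 1 ≤ K) :
    (Timed.foldl (𝔊.explore c x G K) (𝔊.initialState c G K).ret l).time +
        32 * (M * (G * K ^ 2 * Q)) *
          (Timed.foldl (𝔊.explore c x G K) (𝔊.initialState c G K).ret l).ret.bdry.length ≤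
      l.length * (71 * (M * (G * K ^ 2 * Q)) + 1) := by
  induction l using List.reverseRecOn with
  | nil => exact (Nat.zero_le _)
  | append_singleton l v ih =>
    obtain ⟨hv, hl⟩ := (List.nodup_concat l v).1 (List.concat_eq_append ▸ hl)
    have hprefix : ∀ m, 2 ^ (𝔊.boundary (l.take m).toFinset).card ≤ M + 1 := fun m => by
      have hmin := hbdry (min m l.length)
      rwa [List.take_append_of_le_length (min_le_right _ _), ← List.take_take,
        List.take_length] at hmin
    have hstep := (stateCorrect_foldl_explore (c := c) hl).time_explore_le (by simpa using hv)
      hQ hG hK (by simpa using hprefix l.length)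
    rw [ret_foldl_concat, time_foldl_concat, List.length_append, List.length_singleton]
    linarith [ih hl hprefix]

end Exploration

section DynamicProgram

variable {Q : ℕ} {root : Equiv.Perm (Fin M)}

theorem card_boundary_nodeOrder_le_logb (hac : 𝔊.groupGraph.IsAcyclic) (hM : 1 ≤ M) (m : ℕ) :
    ((𝔊.boundary ((𝔊.nodeOrder c root).ret.take m).toFinset).card : ℝ) ≤ Real.logb 2 M + 1 := by
  have hpow : (2 : ℝ) ^ (𝔊.boundary ((𝔊.nodeOrder c root).ret.take m).toFinset).card ≤ M * 2 := by
    have hnat := two_pow_card_boundary_nodeOrder_le (c := c) hac root m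
    exact_mod_cast (by omega : _ ≤ M * 2)
  have hM0 : (0 : ℝ) < M := by exact_mod_cast hM
  have hlog := Real.logb_le_logb_of_le one_lt_two (by positivity) hpow
  rwa [Real.logb_mul hM0.ne' two_ne_zero, Real.logb_self_eq_one one_lt_two,
    Real.logb_pow, Real.logb_self_eq_one one_lt_two, mul_one] at hlog

theorem time_dynamicProgram :
    (𝔊.dynamicProgram c x G K root).time = (𝔊.nodeOrder c root).time +
      ((𝔊.initialState c G K).time + ((Timed.foldl (𝔊.explore c x G K)
        (𝔊.initialState c G K).ret (𝔊.nodeOrder c root).ret).time +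
      (1 + ((𝔊.finalEntry c x G K root).groups.length +
        (𝔊.finalEntry c x G K root).batches.length +
        (𝔊.finalEntry c x G K root).batches.flatten.length)))) :=
  rfl

theorem length_finalEntry_le (hac : 𝔊.groupGraph.IsAcyclic) :
    (𝔊.finalEntry c x G K root).groups.length + (𝔊.finalEntry c x G K root).batches.length +
      (𝔊.finalEntry c x G K root).batches.flatten.length ≤ 2 * M + K := by
  have hbest := isBest_finalEntry (c := c) (x := x) (G := G) (K := K) (root := root) hac
  have hgroups : (𝔊.finalEntry c x G K root).groups.length ≤ M := by
    simpa using hbest.groups_nodup.length_le_card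
  have hbatches := hbest.batches_length
  have helems := hbest.elems_length_le
  omega

theorem time_foldl_explore_nodeOrder_le (hac : 𝔊.groupGraph.IsAcyclic)
    (hQ : 𝔊.SubroutineBound x c Q) (hG : 1 ≤ G) (hK : 1 ≤ K) :
    (Timed.foldl (𝔊.explore c x G K) (𝔊.initialState c G K).ret
      (𝔊.nodeOrder c root).ret).time ≤ M * (71 * (M * (G * K ^ 2 * Q)) + 1) := by
  have hnodup := nodup_nodeOrder (c := c) hac root
  have hlength : (𝔊.nodeOrder c root).ret.length ≤ M := by simpa using hnodup.length_le_card
  exact (Nat.le_add_right _ _).trans ((time_foldl_explore_le hnodup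
    (two_pow_card_boundary_nodeOrder_le hac root) hQ hG hK).trans (Nat.mul_le_mul_right _ hlength))

theorem time_dynamicProgram_le (hac : 𝔊.groupGraph.IsAcyclic) (hQ : 𝔊.SubroutineBound x c Q)
    (hM : 1 ≤ M) (hG : 1 ≤ G) (hK : 1 ≤ K) :
    (𝔊.dynamicProgram c x G K root).time ≤ 91 * (M ^ 2 * G * K ^ 2 * Q) := by
  have horder := time_nodeOrder_le hac hQ.adjacent_le root
  have hinit := time_initialState_le hQ.adjacent_le hG hK
  have hexplore := time_foldl_explore_nodeOrder_le (root := root) hac hQ hG hK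
  have hread := length_finalEntry_le (c := c) (x := x) (G := G) (K := K) (root := root) hac
  have hwork : 91 * (M ^ 2 * G * K ^ 2 * Q) = 91 * (M ^ 2 * (G * K ^ 2 * Q)) := by ring
  have hone : 1 ≤ M ^ 2 * Q := Nat.mul_pos (by positivity) hQ.one_le
  have hQw : M ^ 2 * Q ≤ M ^ 2 * (G * K ^ 2 * Q) :=
    Nat.mul_le_mul_left _ (Nat.le_mul_of_pos_left _ (by positivity))
  have hMM : M ^ 2 ≤ M ^ 2 * Q := Nat.le_mul_of_pos_right _ hQ.one_le
  have hM' : M ≤ M ^ 2 := Nat.le_self_pow two_ne_zero M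
  have hGK : G * K ≤ M ^ 2 * (G * K ^ 2 * Q) :=
    (hQ.mul_le hK).trans (Nat.le_mul_of_pos_left _ (by positivity))
  have hK' : K ≤ G * K := Nat.le_mul_of_pos_left _ hG
  rw [time_dynamicProgram, hwork]
  linarith

end DynamicProgram

end GroupStructure

theorem theorem1 :
    ∃ C : ℕ, ∀ (N M G K : ℕ) (𝔊 : GroupStructure N M) (x : Fin N → ℝ) (root : Equiv.Perm (Fin M)),
      1 ≤ M → 1 ≤ G → 1 ≤ K → 𝔊.LooplessPairwiseOverlapping →
      -- the node picking order enumerates the nodes, with few boundary nodes at every step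
      (∀ c : CostModel,
        (𝔊.nodeOrder c root).ret.Nodup ∧ (∀ v, v ∈ (𝔊.nodeOrder c root).ret) ∧
        ∀ m ≤ M, ((𝔊.boundary ((𝔊.nodeOrder c root).ret.take m).toFinset).card : ℝ) ≤
          Real.logb 2 M + 1) ∧
      -- the dynamic program returns an optimal solution and its value
      (∀ c : CostModel,
        𝔊.IsOptimal x G K (listIndicator (𝔊.dynamicProgram c x G K root).ret.groups)
          (listIndicator (𝔊.dynamicProgram c x G K root).ret.elems) ∧
        (𝔊.dynamicProgram c x G K root).ret.val =
          GroupStructure.objective x (listIndicator (𝔊.dynamicProgram c x G K root).ret.elems)) ∧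
      -- its running time
      (𝔊.dynamicProgram .unit x G K root).time ≤ C * (M ^ 2 * G * K ^ 2) ∧
      (𝔊.dynamicProgram .elementary x G K root).time ≤
        C * (M ^ 2 * G * K ^ 2) * (M + N + 1) ^ 2 := by
  refine ⟨91, fun N M G K 𝔊 x root hM hG hK h𝔊 => ⟨fun c => ?_, fun c => ?_, ?_, ?_⟩⟩
  · exact ⟨GroupStructure.nodup_nodeOrder h𝔊.2 root, GroupStructure.mem_nodeOrder h𝔊.2 root,
      fun m _ => GroupStructure.card_boundary_nodeOrder_le_logb h𝔊.2 hM m⟩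
  · exact ⟨GroupStructure.isOptimal_dynamicProgram h𝔊.2,
      GroupStructure.ret_dynamicProgram_val h𝔊.2⟩
  · simpa using GroupStructure.time_dynamicProgram_le h𝔊.2
      GroupStructure.subroutineBound_unit hM hG hK
  · simpa [mul_assoc] using GroupStructure.time_dynamicProgram_le h𝔊.2
      GroupStructure.subroutineBound_elementary hM hG hK
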